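/- Conventions. Let $M$ be a smooth manifold, $V\to M$ a smooth real vector bundle of finite rank, $\nabla$ a smooth connection on $V$, and $\pi\colon X=\mathrm{tot}(V)\to M$ the total space. For a vector bundle $W$, the bundle $W\oplus W^\vee$ carries the pairing $\langle v+f,w+g\rangle=-\tfrac12(f(w)+g(v))$, and a generalized almost complex structure on $W$ is a smooth bundle automorphism of $W\oplus W^\vee$ that preserves the pairing and squares to $-1$. A generalized almost complex structure $\mathcal J$ on a manifold $Y$ is one on the bundle $T_Y$; it is integrable (a generalized complex structure) if the sheaf of sections of its $+i$-eigenbundle in $(T_Y\oplus T_Y^\vee)\otimes\mathbb C$ is closed under the Courant bracket $$[A+\xi,B+\eta]=[A,B]+\mathcal L_A\eta-\mathcal L_B\xi+\tfrac12\,d(\iota_B\xi-\iota_A\eta).$$ An almost Dirac structure on $M$ is a maximally isotropic smooth subbundle of $T_M\oplus T_M^\vee$; it is a Dirac structure (integrable) if its sheaf of sections is closed under the Courant bracket. Let $j\colon\pi^*V\to T_X$ be the vertical inclusion, $D\colon T_X\to\pi^*V$ the projection $D=(\pi^*\nabla)(S)$, where $S$ is the tautological section of $\pi^*V$, and $\alpha\colon\pi^*T_M\to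 T_X$ the horizontal lift, with $d\pi\circ\alpha=1$ and $D\circ\alpha=0$. They give an isomorphism $$F\colon T_X\oplus T_X^\vee\to\pi^*(V\oplus T_M\oplus V^\vee\oplus T_M^\vee),\qquad F(w+\xi)=\bigl(D(w),\,d\pi(w),\,j^\vee\xi,\,\alpha^\vee\xi\bigr).$$ Suppose that $\nabla$ is flat. A generalized almost complex structure $\mathcal J$ on $X$ is called $\nabla$-semi-flat if $\mathcal J=F^{-1}(\pi^*\underline{\mathcal J})F$ for some generalized almost complex structure $\underline{\mathcal J}$ on the bundle $V\oplus T_M$ over $M$ with $\underline{\mathcal J}(V\oplus V^\vee)=T_M\oplus T_M^\vee$. Statement. Let $\nabla$ be flat and let $\mathcal J$ be an integrable $\nabla$-semi-flat generalized almost complex structure on $X$. Then the structure $\underline{\mathcal J}$ on $V\oplus T_M$ with $\mathcal J=F^{-1}(\pi^*\underline{\mathcal J})F$ is unique, and the following hold for $$\Delta=\underline{\mathcal J}(V),\qquad \widehat\Delta=\underline{\mathcal J}(V^\vee)\qquad\text{in } T_M\oplus T_M^\vee.$$ 1. $\Delta$ and $\widehat\Delta$ are (integrable) Dirac structures on $M$.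 2. They are transverse: $\Delta\oplus\widehat\Delta=T_M\oplus T_M^\vee$. 3. They inherit flat connections through $\underline{\mathcal J}$: there are flat connections $\nabla^{\Delta}$ on $\Delta$ and $\nabla^{\widehat\Delta}$ on $\widehat\Delta$ such that $\nabla^{\Delta}_v(\underline{\mathcal J}s)=\underline{\mathcal J}(\nabla_v s)$ and $\nabla^{\widehat\Delta}_v(\underline{\mathcal J}\sigma)=\underline{\mathcal J}(\nabla^\vee_v\sigma)$ for all tangent vectors $v$ and all local sections $s$ of $V$ and $\sigma$ of $V^\vee$, where $\nabla^\vee$ is the connection on $V^\vee$ dual to $\nabla$. -/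

import Mathlib

open Bundle Set FiberBundle
open scoped Manifold ContDiff Topology

set_option linter.unusedSectionVars false

noncomputable section

namespace GenGeom

/-! ### Smooth sections, and the bundle `W ⊕ W^∨` -/

section Sections

variable {E : Type*} [NormedAddCommGroup E] [NormedSpace ℝ E]
  {H : Type*} [TopologicalSpace H] (I : ModelWithCorners ℝ E H)
  {B : Type*} [TopologicalSpace B] [ChartedSpace H B]
  (F : Type*) [NormedAddCommGroup F] [NormedSpace ℝ F]
  {W : B → Type*} [TopologicalSpace (TotalSpace F W)]
  [∀ x, AddCommGroup (W x)] [∀ x, Module ℝ (W x)]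
  [∀ x, TopologicalSpace (W x)] [FiberBundle F W]

/-- The section `s` of the bundle `W` (with model fibre `F`) is smooth on the set `U`.
Local sections over `U` are encoded as functions on `B` whose values outside `U` are irrelevant. -/
def SmoothOn (U : Set B) (s : Π x, W x) : Prop :=
  ContMDiffOn I (I.prod 𝓘(ℝ, F)) ∞ (fun x ↦ TotalSpace.mk' F x (s x)) U

variable [∀ x, IsTopologicalAddGroup (W x)] [∀ x, ContinuousSMul ℝ (W x)] [VectorBundle ℝ F W]

/-- Smoothness on `U` of a section of the dual bundle `W^∨`. -/
def DualSmoothOn (U : Set B) (ξ : Π x, W x →L[ℝ] ℝ) : Prop :=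
  ContMDiffOn I (I.prod 𝓘(ℝ, F →L[ℝ] ℝ)) ∞
    (fun x ↦ TotalSpace.mk' (F →L[ℝ] ℝ) (E := fun x ↦ W x →L[ℝ] Bundle.Trivial B ℝ x) x (ξ x)) U

variable (W) in
/-- The fibre at `x` of the bundle `W ⊕ W^∨`. -/
abbrev Gen (x : B) : Type _ := W x × (W x →L[ℝ] ℝ)

/-- Smoothness on `U` of a section of `W ⊕ W^∨`. -/
def GenSmoothOn (U : Set B) (a : Π x, Gen W x) : Prop :=
  SmoothOn I F U (fun x ↦ (a x).1) ∧ DualSmoothOn I F U (fun x ↦ (a x).2)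

end Sections

section Dual

variable {E : Type*} [NormedAddCommGroup E] [NormedSpace ℝ E]
  {H : Type*} [TopologicalSpace H] (I : ModelWithCorners ℝ E H)
  {B : Type*} [TopologicalSpace B] [ChartedSpace H B]
  (F : Type*) [NormedAddCommGroup F] [NormedSpace ℝ F]
  {W : B → Type*} [TopologicalSpace (TotalSpace F W)]
  [∀ x, AddCommGroup (W x)] [∀ x, Module ℝ (W x)]
  [∀ x, TopologicalSpace (W x)] [FiberBundle F W]
  [∀ x, IsTopologicalAddGroup (W x)] [∀ x, ContinuousSMul ℝ (W x)] [VectorBundle ℝ F W]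

/-- Differentiability at `x` of a section of the dual bundle `W^∨`. -/
def DualMDiffAt (ξ : Π x, W x →L[ℝ] ℝ) (x : B) : Prop :=
  MDifferentiableAt I (I.prod 𝓘(ℝ, F →L[ℝ] ℝ))
    (fun x ↦ TotalSpace.mk' (F →L[ℝ] ℝ) (E := fun x ↦ W x →L[ℝ] Bundle.Trivial B ℝ x) x (ξ x)) x

variable {I F}

theorem DualMDiffAt.apply {ξ : Π x, W x →L[ℝ] ℝ} {x : B} (h : DualMDiffAt I F ξ x)
    {s : Π x, W x} (hs : MDifferentiableAt I (I.prod 𝓘(ℝ, F)) (fun x ↦ TotalSpace.mk' F x (s x)) x) :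
    MDifferentiableAt I 𝓘(ℝ, ℝ) (fun y ↦ ξ y (s y)) x := by
  have := MDifferentiableAt.clm_bundle_apply (F₁ := F) (F₂ := ℝ)
    (E₂ := Bundle.Trivial B ℝ) h hs
  exact (mdifferentiableAt_section I (fun y ↦ ξ y (s y)) (F := ℝ) (E := Bundle.Trivial B ℝ)).1 this

end Dual

/-- The standard symmetric pairing on `W ⊕ W^∨`. -/
def pairing {W : Type*} [AddCommGroup W] [Module ℝ W] [TopologicalSpace W]
    (a b : W × (W →L[ℝ] ℝ)) : ℝ :=
  -(1 / 2) * (a.2 b.1 + b.2 a.1)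

section GACS

variable {E : Type*} [NormedAddCommGroup E] [NormedSpace ℝ E]
  {H : Type*} [TopologicalSpace H] (I : ModelWithCorners ℝ E H)
  {B : Type*} [TopologicalSpace B] [ChartedSpace H B]
  (F : Type*) [NormedAddCommGroup F] [NormedSpace ℝ F]
  (W : B → Type*) [TopologicalSpace (TotalSpace F W)]
  [∀ x, AddCommGroup (W x)] [∀ x, Module ℝ (W x)]
  [∀ x, TopologicalSpace (W x)] [FiberBundle F W]
  [∀ x, IsTopologicalAddGroup (W x)] [∀ x, ContinuousSMul ℝ (W x)] [VectorBundle ℝ F W]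

/-- A generalized almost complex structure on the vector bundle `W`: a smooth endomorphism `J` of
the bundle `W ⊕ W^∨` which is orthogonal for the standard pairing and satisfies `J² = -1`.
Smoothness of `J` means that it maps smooth local sections to smooth local sections. -/
@[ext]
structure GACS where
  J : Π x : B, Gen W x →L[ℝ] Gen W x
  smooth : ∀ (U : Set B) (a : Π x, Gen W x), IsOpen U → GenSmoothOn I F U a →
    GenSmoothOn I F U (fun x ↦ J x (a x))
  orthogonal : ∀ x (a b : Gen W x), pairing (J x a) (J x b) = pairing a b
  sq : ∀ x (a : Gen W x), J x (J x a) = -a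

end GACS

/-! ### The Courant bracket -/

section Courant

variable {E : Type*} [NormedAddCommGroup E] [NormedSpace ℝ E] [FiniteDimensional ℝ E]
  {H : Type*} [TopologicalSpace H] (I : ModelWithCorners ℝ E H)
  {B : Type*} [TopologicalSpace B] [ChartedSpace H B]

section ExtDer

variable [IsManifold I 2 B]

/-- The right-hand side of the invariant formula
`dη(X, Y) = X(η(Y)) - Y(η(X)) - η([X, Y])`. -/
def extDerAux (η : Π x : B, TangentSpace I x →L[ℝ] ℝ) (x : B) (X Y : Π x : B, TangentSpace I x) :
    ℝ :=
  mvfderiv I (fun y ↦ η y (Y y)) x (X x) - mvfderiv I (fun y ↦ η y (X y)) x (Y x)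
    - η x (VectorField.mlieBracket I X Y x)

variable {I}

theorem extDerAux_swap (η : Π x : B, TangentSpace I x →L[ℝ] ℝ) (x : B)
    (X Y : Π x : B, TangentSpace I x) : extDerAux I η x X Y = - extDerAux I η x Y X := by
  simp only [extDerAux]
  rw [VectorField.mlieBracket_swap_apply, map_neg]
  ring

theorem extDerAux_tensorial {η : Π x : B, TangentSpace I x →L[ℝ] ℝ} {x : B}
    (h : DualMDiffAt I E η x) (Y : Π x : B, TangentSpace I x) (_hY : MDiffAt (T% Y) x) :
    TensorialAt I E (fun X ↦ extDerAux I η x X Y) x := by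
  have : CompleteSpace E := FiniteDimensional.complete ℝ E
  constructor
  · intro f X hf hX
    have e : (fun y ↦ η y ((f • X) y)) = f • fun y ↦ η y (X y) := by
      ext y; simp
    simp only [extDerAux]
    rw [e, mvfderiv_smul hf (h.apply hX), VectorField.mlieBracket_smul_left hf hX]
    simp
    ring
  · intro X X' hX hX'
    have e : (fun y ↦ η y ((X + X') y)) = (fun y ↦ η y (X y)) + fun y ↦ η y (X' y) := by
      ext y; simp
    simp only [extDerAux]
    rw [e, mvfderiv_add (h.apply hX) (h.apply hX'), VectorField.mlieBracket_add_left hX hX']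
    simp
    ring

variable (I)

open Classical in
/-- The exterior derivative `dη` of a one-form, at `x`, as the bilinear form on the tangent space
with `dη(X, Y) = X(η(Y)) - Y(η(X)) - η([X, Y])` for all vector fields `X`, `Y` (see
`extDer_apply`); by convention it is `0` where `η` is not differentiable. -/
def extDer (η : Π x : B, TangentSpace I x →L[ℝ] ℝ) (x : B) :
    TangentSpace I x →L[ℝ] TangentSpace I x →L[ℝ] ℝ :=
  if h : DualMDiffAt I E η x then
    TensorialAt.mkHom₂ (I := I) (F := E) (F' := E) (extDerAux I η x) x
      (fun Y hY ↦ extDerAux_tensorial h Y hY)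
      (fun X hX ↦ by
        have hT := extDerAux_tensorial h X hX
        constructor
        · intro f Y hf hY
          rw [extDerAux_swap, hT.smul hf hY, extDerAux_swap η x X Y, smul_neg]
        · intro Y Y' hY hY'
          rw [extDerAux_swap, hT.add hY hY', extDerAux_swap η x X Y, extDerAux_swap η x X Y',
            neg_add])
  else 0

theorem extDer_apply {η : Π x : B, TangentSpace I x →L[ℝ] ℝ} {x : B} (h : DualMDiffAt I E η x)
    {X Y : Π x : B, TangentSpace I x} (hX : MDiffAt (T% X) x) (hY : MDiffAt (T% Y) x) :
    extDer I η x (X x) (Y x) =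
      mvfderiv I (fun y ↦ η y (Y y)) x (X x) - mvfderiv I (fun y ↦ η y (X y)) x (Y x)
        - η x (VectorField.mlieBracket I X Y x) := by
  rw [extDer, dif_pos h]
  exact TensorialAt.mkHom₂_apply _ _ hX hY

end ExtDer

variable [IsManifold I 2 B]

/-- The Lie derivative `L_X η = ι_X dη + d(ι_X η)` of a one-form. -/
def lieDer (X : Π x : B, TangentSpace I x) (η : Π x : B, TangentSpace I x →L[ℝ] ℝ) (x : B) :
    TangentSpace I x →L[ℝ] ℝ :=
  extDer I η x (X x) + mvfderiv I (fun y ↦ η y (X y)) x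

/-- The Courant bracket
`[X + ξ, Y + η] = [X, Y] + L_X η - L_Y ξ + (1/2) d(ι_Y ξ - ι_X η)` of sections of `T ⊕ T^∨`. -/
def courant (a b : Π x : B, Gen (TangentSpace I : B → Type _) x) (x : B) :
    Gen (TangentSpace I : B → Type _) x :=
  (VectorField.mlieBracket I (fun y ↦ (a y).1) (fun y ↦ (b y).1) x,
    lieDer I (fun y ↦ (a y).1) (fun y ↦ (b y).2) x
      - lieDer I (fun y ↦ (b y).1) (fun y ↦ (a y).2) x
      + (1 / 2 : ℝ) • mvfderiv I (fun y ↦ (a y).2 (b y).1 - (b y).2 (a y).1) x)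

/-! ### Generalized complex structures on manifolds -/

/-- `a + i b`, an element of `(T ⊕ T^∨) ⊗ ℂ`, lies in the `+i`-eigenspace of the complex-linear
extension of `J`. -/
def MemEigen {x : B} (J : Gen (TangentSpace I : B → Type _) x →L[ℝ] Gen (TangentSpace I : B → Type _) x)
    (a b : Gen (TangentSpace I : B → Type _) x) : Prop :=
  J a = -b ∧ J b = a

variable {I} in
/-- A generalized almost complex structure on the manifold `B` is integrable (that is, a generalized
complex structure) if the sheaf of smooth sections of its `+i`-eigenbundle in `(T ⊕ T^∨) ⊗ ℂ` is
closed under the complex-bilinear extension of the Courant bracket. The two complex sections are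
`a + i b` and `c + i d`. -/
def GACS.IsIntegrable (𝒥 : GACS I E (TangentSpace I : B → Type _)) : Prop :=
  ∀ (U : Set B) (a b c d : Π x : B, Gen (TangentSpace I : B → Type _) x), IsOpen U →
    GenSmoothOn I E U a → GenSmoothOn I E U b → GenSmoothOn I E U c → GenSmoothOn I E U d →
    (∀ x ∈ U, MemEigen I (𝒥.J x) (a x) (b x)) → (∀ x ∈ U, MemEigen I (𝒥.J x) (c x) (d x)) →
    ∀ x ∈ U, MemEigen I (𝒥.J x)
      (courant I a c x - courant I b d x) (courant I a d x + courant I b c x)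

/-! ### Dirac structures -/

/-- The family `Δ` of subspaces of the fibres of `T ⊕ T^∨` is a smooth subbundle: near every point
it has a smooth frame (of some finite length `k`). -/
def IsSubbundle (Δ : Π x : B, Submodule ℝ (Gen (TangentSpace I : B → Type _) x)) : Prop :=
  ∀ x₀, ∃ (U : Set B) (k : ℕ) (s : Fin k → Π x : B, Gen (TangentSpace I : B → Type _) x),
    IsOpen U ∧ x₀ ∈ U ∧ (∀ i, GenSmoothOn I E U (s i)) ∧
    ∀ x ∈ U, LinearIndependent ℝ (fun i ↦ s i x) ∧ Submodule.span ℝ (range fun i ↦ s i x) = Δ x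

/-- A subspace of `W ⊕ W^∨` is isotropic if the pairing vanishes on it. -/
def IsIsotropic {W : Type*} [AddCommGroup W] [Module ℝ W] [TopologicalSpace W]
    [IsTopologicalAddGroup W] [ContinuousSMul ℝ W]
    (S : Submodule ℝ (W × (W →L[ℝ] ℝ))) : Prop :=
  ∀ a ∈ S, ∀ b ∈ S, pairing a b = 0

/-- An almost Dirac structure: a maximally isotropic smooth subbundle of `T ⊕ T^∨`. -/
def IsAlmostDirac (Δ : Π x : B, Submodule ℝ (Gen (TangentSpace I : B → Type _) x)) : Prop :=
  IsSubbundle I Δ ∧ ∀ x, Maximal IsIsotropic (Δ x)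

/-- `s` is a smooth section over `U` of the family of subspaces `Δ` of `T ⊕ T^∨`. -/
def IsSectionOn (Δ : Π x : B, Submodule ℝ (Gen (TangentSpace I : B → Type _) x)) (U : Set B)
    (s : Π x : B, Gen (TangentSpace I : B → Type _) x) : Prop :=
  GenSmoothOn I E U s ∧ ∀ x ∈ U, s x ∈ Δ x

/-- A Dirac structure: an almost Dirac structure whose sheaf of smooth sections is closed under the
Courant bracket. -/
def IsDirac (Δ : Π x : B, Submodule ℝ (Gen (TangentSpace I : B → Type _) x)) : Prop :=
  IsAlmostDirac I Δ ∧ ∀ (U : Set B) (a b : Π x : B, Gen (TangentSpace I : B → Type _) x), IsOpen U →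
    IsSectionOn I Δ U a → IsSectionOn I Δ U b → ∀ x ∈ U, courant I a b x ∈ Δ x

/-- A (smooth) connection on a subbundle `Δ` of `T ⊕ T^∨`: a map of sheaves
`∇ : Δ → Δ ⊗ T^∨` with `∇(f s) = s ⊗ df + f ∇ s`. Here `∇ s x v` is the derivative of the section
`s` at `x` in the direction `v`; only its values on smooth local sections of `Δ` are meaningful. -/
structure SubbundleConnection
    (Δ : Π x : B, Submodule ℝ (Gen (TangentSpace I : B → Type _) x)) where
  toFun : (Π x : B, Gen (TangentSpace I : B → Type _) x) →
    Π x : B, TangentSpace I x →L[ℝ] Gen (TangentSpace I : B → Type _) x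
  congr : ∀ (U : Set B) s s', IsOpen U → IsSectionOn I Δ U s → IsSectionOn I Δ U s' →
    (∀ x ∈ U, s x = s' x) → ∀ x ∈ U, toFun s x = toFun s' x
  isSectionOn : ∀ (U : Set B) (s) (X : Π x : B, TangentSpace I x), IsOpen U → IsSectionOn I Δ U s →
    SmoothOn I E U X → IsSectionOn I Δ U (fun x ↦ toFun s x (X x))
  add : ∀ (U : Set B) s s', IsOpen U → IsSectionOn I Δ U s → IsSectionOn I Δ U s' →
    ∀ x ∈ U, toFun (fun y ↦ s y + s' y) x = toFun s x + toFun s' x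
  leibniz : ∀ (U : Set B) (f : B → ℝ) (s), IsOpen U → ContMDiffOn I 𝓘(ℝ, ℝ) ∞ f U →
    IsSectionOn I Δ U s → ∀ x ∈ U, ∀ v : TangentSpace I x,
      toFun (fun y ↦ f y • s y) x v = f x • toFun s x v + mvfderiv I f x v • s x

variable {I} in
/-- A connection on the subbundle `Δ` is flat if its curvature
`∇_X ∇_Y - ∇_Y ∇_X - ∇_{[X, Y]}` vanishes. -/
def SubbundleConnection.IsFlat
    {Δ : Π x : B, Submodule ℝ (Gen (TangentSpace I : B → Type _) x)}
    (D : SubbundleConnection I Δ) : Prop :=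
  ∀ (U : Set B) (X Y : Π x : B, TangentSpace I x) (s), IsOpen U → SmoothOn I E U X →
    SmoothOn I E U Y → IsSectionOn I Δ U s → ∀ x ∈ U,
      D.toFun (fun y ↦ D.toFun s y (Y y)) x (X x) - D.toFun (fun y ↦ D.toFun s y (X y)) x (Y x)
        - D.toFun s x (VectorField.mlieBracket I X Y x) = 0

end Courant

/-! ### Connections on vector bundles, and semi-flat structures on their total spaces -/

section VectorBundle

variable {E : Type*} [NormedAddCommGroup E] [NormedSpace ℝ E] [FiniteDimensional ℝ E]
  {M : Type*} [TopologicalSpace M] [ChartedSpace E M] [IsManifold 𝓘(ℝ, E) ∞ M]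
  {F : Type*} [NormedAddCommGroup F] [NormedSpace ℝ F] [FiniteDimensional ℝ F]
  {V : M → Type*} [TopologicalSpace (TotalSpace F V)]
  [∀ x, AddCommGroup (V x)] [∀ x, Module ℝ (V x)] [∀ x, TopologicalSpace (V x)]
  [∀ x, IsTopologicalAddGroup (V x)] [∀ x, ContinuousSMul ℝ (V x)]
  [FiberBundle F V] [VectorBundle ℝ F V] [ContMDiffVectorBundle ∞ F V 𝓘(ℝ, E)]

/-- The connection `∇` on `V` is flat: its curvature `∇_X ∇_Y - ∇_Y ∇_X - ∇_{[X, Y]}` vanishes. -/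
def IsFlat (cov : CovariantDerivative 𝓘(ℝ, E) F V) : Prop :=
  ∀ (U : Set M) (X Y : Π x : M, TangentSpace 𝓘(ℝ, E) x) (s : Π x, V x), IsOpen U →
    SmoothOn 𝓘(ℝ, E) E U X → SmoothOn 𝓘(ℝ, E) E U Y → SmoothOn 𝓘(ℝ, E) F U s → ∀ x ∈ U,
      cov (fun y ↦ cov s y (Y y)) x (X x) - cov (fun y ↦ cov s y (X y)) x (Y x)
        - cov s x (VectorField.mlieBracket 𝓘(ℝ, E) X Y x) = 0

theorem dualCov_tensorial (cov : CovariantDerivative 𝓘(ℝ, E) F V) {ξ : Π x, V x →L[ℝ] ℝ} {x : M}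
    (h : DualMDiffAt 𝓘(ℝ, E) F ξ x) (v : TangentSpace 𝓘(ℝ, E) x) :
    TensorialAt 𝓘(ℝ, E) F
      (fun s ↦ mvfderiv 𝓘(ℝ, E) (fun y ↦ ξ y (s y)) x v - ξ x (cov s x v)) x := by
  constructor
  · intro f s hf hs
    have e : (fun y ↦ ξ y ((f • s) y)) = f • fun y ↦ ξ y (s y) := by
      ext y; simp
    rw [e, mvfderiv_smul hf (h.apply hs), cov.isCovariantDerivativeOnUniv.leibniz hs hf]
    simp
    ring
  · intro s s' hs hs'
    have e : (fun y ↦ ξ y ((s + s') y)) = (fun y ↦ ξ y (s y)) + fun y ↦ ξ y (s' y) := by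
      ext y; simp
    rw [e, mvfderiv_add (h.apply hs) (h.apply hs'), cov.isCovariantDerivativeOnUniv.add hs hs']
    simp
    ring

open Classical in
/-- The value at `x` of `∇^∨ ξ`, where `∇^∨` is the connection on `V^∨` dual to `∇`:
`(∇^∨_v ξ)(s) = v(ξ(s)) - ξ(∇_v s)` for all sections `s` of `V` (see `dualCov_apply`). By
convention it is `0` where `ξ` is not differentiable. -/
def dualCov (cov : CovariantDerivative 𝓘(ℝ, E) F V) (ξ : Π x, V x →L[ℝ] ℝ) (x : M) :
    TangentSpace 𝓘(ℝ, E) x →L[ℝ] V x →L[ℝ] ℝ :=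
  if h : DualMDiffAt 𝓘(ℝ, E) F ξ x then
    haveI : FiniteDimensional ℝ (TangentSpace 𝓘(ℝ, E) x) := inferInstanceAs (FiniteDimensional ℝ E)
    haveI : T2Space (TangentSpace 𝓘(ℝ, E) x) := inferInstanceAs (T2Space E)
    LinearMap.toContinuousLinearMap
      { toFun := fun v ↦ TensorialAt.mkHom _ x (dualCov_tensorial cov h v)
        map_add' := fun v w ↦ by
          ext e
          simp only [TensorialAt.mkHom_apply_eq_extend, add_apply, map_add]
          ring
        map_smul' := fun c v ↦ by
          ext e
          simp only [TensorialAt.mkHom_apply_eq_extend, smul_apply, map_smul,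
            RingHom.id_apply, smul_eq_mul]
          ring }
  else 0

theorem dualCov_apply (cov : CovariantDerivative 𝓘(ℝ, E) F V) {ξ : Π x, V x →L[ℝ] ℝ} {x : M}
    (h : DualMDiffAt 𝓘(ℝ, E) F ξ x) {s : Π x, V x} (hs : MDiffAt (T% s) x)
    (v : TangentSpace 𝓘(ℝ, E) x) :
    dualCov cov ξ x v (s x) = mvfderiv 𝓘(ℝ, E) (fun y ↦ ξ y (s y)) x v - ξ x (cov s x v) := by
  rw [dualCov, dif_pos h]
  exact TensorialAt.mkHom_apply (dualCov_tensorial cov h v) hs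

/-- The derivative at the point `p` of the parametrization `w ↦ (π(p), e⁻¹ w)` of the fibre through
`p` given by the preferred trivialization `e` at `π(p)`. -/
def fibDeriv (p : TotalSpace F V) : F →L[ℝ] TangentSpace (𝓘(ℝ, E).prod 𝓘(ℝ, F)) p :=
  mfderiv 𝓘(ℝ, F) (𝓘(ℝ, E).prod 𝓘(ℝ, F))
    (fun w : F ↦ TotalSpace.mk' F p.proj ((trivializationAt F V p.proj).symm p.proj w))
    (trivializationAt F V p.proj p).2

/-- The vertical inclusion `j : V_{π(p)} → T_p X`, where `X` is the total space of `V`: the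
derivative of the inclusion of the fibre through `p`. -/
def vert (p : TotalSpace F V) :
    V p.proj →L[ℝ] TangentSpace (𝓘(ℝ, E).prod 𝓘(ℝ, F)) p :=
  (fibDeriv p).comp ((trivializationAt F V p.proj).continuousLinearMapAt ℝ p.proj)

variable (E) in
/-- The differential `dπ : T_p X → T_{π(p)} M` of the projection. -/
def dproj (p : TotalSpace F V) :
    TangentSpace (𝓘(ℝ, E).prod 𝓘(ℝ, F)) p →L[ℝ] TangentSpace 𝓘(ℝ, E) p.proj :=
  mfderiv (𝓘(ℝ, E).prod 𝓘(ℝ, F)) 𝓘(ℝ, E) (fun q : TotalSpace F V ↦ q.proj) p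

/-- The projection `D = (π^*∇)(S) : T_p X → V_{π(p)}` given by the connection, `S` being the
tautological section of `π^* V`. In a local frame `e_i` of `V` with fibre coordinates `ξ_i` one has
`S = ∑ ξ_i e_i` and `D(w) = ∑ dξ_i(w) e_i + ∑ ξ_i(p) ∇_{dπ(w)} e_i`. Here the frame is that of the
preferred trivialization at `π(p)`, and `extend F p.2` is the section `∑ ξ_i(p) e_i`. -/
def connProj (cov : CovariantDerivative 𝓘(ℝ, E) F V) (p : TotalSpace F V) :
    TangentSpace (𝓘(ℝ, E).prod 𝓘(ℝ, F)) p →L[ℝ] V p.proj :=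
  letI e := trivializationAt F V p.proj
  ((e.symmL ℝ p.proj).comp
      (mvfderiv (𝓘(ℝ, E).prod 𝓘(ℝ, F)) (fun q : TotalSpace F V ↦ (e q).2) p))
    + (cov (extend F p.2) p.proj).comp (dproj E p)

/-- The derivative at `π(p)` of the local section `extend F p.2` of `V` through `p`, as a map into the
total space. -/
def secDeriv (p : TotalSpace F V) :
    TangentSpace 𝓘(ℝ, E) p.proj →L[ℝ] TangentSpace (𝓘(ℝ, E).prod 𝓘(ℝ, F)) p :=
  mfderiv 𝓘(ℝ, E) (𝓘(ℝ, E).prod 𝓘(ℝ, F))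
    (fun x ↦ TotalSpace.mk' F x (extend F p.2 x)) p.proj

/-- The horizontal lift `α : T_{π(p)} M → T_p X`, the splitting of `dπ` with `D ∘ α = 0`: for a local
section `s` of `V` through `p`, `α(v) = ds(v) - j(∇_v s)`. -/
def horLift (cov : CovariantDerivative 𝓘(ℝ, E) F V) (p : TotalSpace F V) :
    TangentSpace 𝓘(ℝ, E) p.proj →L[ℝ] TangentSpace (𝓘(ℝ, E).prod 𝓘(ℝ, F)) p :=
  secDeriv p - (vert p).comp (cov (extend F p.2) p.proj)

variable (E V) in
/-- The bundle `V ⊕ T_M` on `M`. -/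
abbrev VT (x : M) : Type _ := V x × TangentSpace 𝓘(ℝ, E) x

/-- The isomorphism `F : T_p X ⊕ T_p^∨ X → V ⊕ T_M ⊕ V^∨ ⊕ T_M^∨`, with the matrix
`(D, dπ) ⊕ (j^∨, α^∨)`. -/
def splitF (cov : CovariantDerivative 𝓘(ℝ, E) F V) (p : TotalSpace F V) :
    Gen (TangentSpace (𝓘(ℝ, E).prod 𝓘(ℝ, F)) : TotalSpace F V → Type _) p →
      Gen (VT E V) p.proj :=
  fun a ↦ ((connProj cov p a.1, dproj E p a.1), a.2.comp ((vert p).coprod (horLift cov p)))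

/-- The inverse `F⁻¹` of `F`, with the matrix `(j, α) ⊕ (D^∨, (dπ)^∨)`. -/
def splitFInv (cov : CovariantDerivative 𝓘(ℝ, E) F V) (p : TotalSpace F V) :
    Gen (VT E V) p.proj →
      Gen (TangentSpace (𝓘(ℝ, E).prod 𝓘(ℝ, F)) : TotalSpace F V → Type _) p :=
  fun b ↦ (vert p b.1.1 + horLift cov p b.1.2, b.2.comp ((connProj cov p).prod (dproj E p)))

/-- `𝒥 = F⁻¹ (π^* J) F`. -/
def IsLiftOf (cov : CovariantDerivative 𝓘(ℝ, E) F V)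
    (𝒥 : GACS (𝓘(ℝ, E).prod 𝓘(ℝ, F)) (E × F)
      (TangentSpace (𝓘(ℝ, E).prod 𝓘(ℝ, F)) : TotalSpace F V → Type _))
    (J : GACS 𝓘(ℝ, E) (F × E) (VT E V)) : Prop :=
  ∀ p a, 𝒥.J p a = splitFInv cov p (J.J p.proj (splitF cov p a))

/-- The inclusion `V ⊕ V^∨ ⊆ (V ⊕ T_M) ⊕ (V ⊕ T_M)^∨`. -/
def inclV (x : M) : Gen V x →ₗ[ℝ] Gen (VT E V) x where
  toFun a := ((a.1, 0), a.2.comp (ContinuousLinearMap.fst ℝ (V x) (TangentSpace 𝓘(ℝ, E) x)))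
  map_add' a b := by ext <;> simp
  map_smul' c a := by ext <;> simp

/-- The inclusion `T_M ⊕ T_M^∨ ⊆ (V ⊕ T_M) ⊕ (V ⊕ T_M)^∨`. -/
def inclT (x : M) : Gen (TangentSpace 𝓘(ℝ, E) : M → Type _) x →ₗ[ℝ] Gen (VT E V) x where
  toFun a := ((0, a.1), a.2.comp (ContinuousLinearMap.snd ℝ (V x) (TangentSpace 𝓘(ℝ, E) x)))
  map_add' a b := by ext <;> simp
  map_smul' c a := by ext <;> simp

/-- The projection of `(V ⊕ T_M) ⊕ (V ⊕ T_M)^∨` onto `T_M ⊕ T_M^∨`. -/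
def projT (x : M) : Gen (VT E V) x →ₗ[ℝ] Gen (TangentSpace 𝓘(ℝ, E) : M → Type _) x where
  toFun b := (b.1.2, b.2.comp (ContinuousLinearMap.inr ℝ (V x) (TangentSpace 𝓘(ℝ, E) x)))
  map_add' a b := by ext <;> simp
  map_smul' c a := by ext <;> simp

/-- The condition `J(V ⊕ V^∨) = T_M ⊕ T_M^∨`. -/
def IsAdapted (J : GACS 𝓘(ℝ, E) (F × E) (VT E V)) : Prop :=
  ∀ x, (LinearMap.range (inclV x)).map (J.J x : Gen (VT E V) x →ₗ[ℝ] Gen (VT E V) x) =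
    LinearMap.range (inclT x)

/-- `𝒥` is an adapted, `∇`-lifted generalized almost complex structure on the total space of `V`;
it is then called `∇`-semi-flat if `∇` is flat. -/
def IsSemiFlat (cov : CovariantDerivative 𝓘(ℝ, E) F V)
    (𝒥 : GACS (𝓘(ℝ, E).prod 𝓘(ℝ, F)) (E × F)
      (TangentSpace (𝓘(ℝ, E).prod 𝓘(ℝ, F)) : TotalSpace F V → Type _)) : Prop :=
  IsFlat cov ∧ ∃ J : GACS 𝓘(ℝ, E) (F × E) (VT E V), IsLiftOf cov 𝒥 J ∧ IsAdapted J

/-- The restriction of `J` to `V ⊕ V^∨`, with values in `T_M ⊕ T_M^∨` (where it takes its values if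
`J` is adapted). -/
def baseMap (J : GACS 𝓘(ℝ, E) (F × E) (VT E V)) (x : M) :
    Gen V x →ₗ[ℝ] Gen (TangentSpace 𝓘(ℝ, E) : M → Type _) x :=
  (projT x).comp ((J.J x : Gen (VT E V) x →ₗ[ℝ] Gen (VT E V) x).comp (inclV x))

/-- `Δ = J(V)`, as a family of subspaces of the fibres of `T_M ⊕ T_M^∨`. -/
def diracV (J : GACS 𝓘(ℝ, E) (F × E) (VT E V)) (x : M) :
    Submodule ℝ (Gen (TangentSpace 𝓘(ℝ, E) : M → Type _) x) :=
  LinearMap.range ((baseMap J x).comp (LinearMap.inl ℝ (V x) (V x →L[ℝ] ℝ)))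

/-- `Δ̂ = J(V^∨)`, as a family of subspaces of the fibres of `T_M ⊕ T_M^∨`. -/
def diracVDual (J : GACS 𝓘(ℝ, E) (F × E) (VT E V)) (x : M) :
    Submodule ℝ (Gen (TangentSpace 𝓘(ℝ, E) : M → Type _) x) :=
  LinearMap.range ((baseMap J x).comp (LinearMap.inr ℝ (V x) (V x →L[ℝ] ℝ)))

end VectorBundle

end GenGeom

end

noncomputable section

namespace GenGeom

section Pointwise

variable {E : Type*} [NormedAddCommGroup E] [NormedSpace ℝ E]
  {H : Type*} [TopologicalSpace H] (I : ModelWithCorners ℝ E H)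
  {B : Type*} [TopologicalSpace B] [ChartedSpace H B]
  (F : Type*) [NormedAddCommGroup F] [NormedSpace ℝ F]
  {W : B → Type*} [TopologicalSpace (TotalSpace F W)]
  [∀ x, AddCommGroup (W x)] [∀ x, Module ℝ (W x)]
  [∀ x, TopologicalSpace (W x)] [FiberBundle F W]

/-- Smoothness at a point of a section of `W`. -/
def SmoothAt (s : Π x, W x) (x₀ : B) : Prop :=
  ContMDiffAt I (I.prod 𝓘(ℝ, F)) ∞ (fun x ↦ TotalSpace.mk' F x (s x)) x₀

variable [∀ x, IsTopologicalAddGroup (W x)] [∀ x, ContinuousSMul ℝ (W x)] [VectorBundle ℝ F W]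

/-- Smoothness at a point of a section of the dual bundle `W^∨`. -/
def DualSmoothAt (ξ : Π x, W x →L[ℝ] ℝ) (x₀ : B) : Prop :=
  ContMDiffAt I (I.prod 𝓘(ℝ, F →L[ℝ] ℝ)) ∞
    (fun x ↦ TotalSpace.mk' (F →L[ℝ] ℝ) (E := fun x ↦ W x →L[ℝ] Bundle.Trivial B ℝ x) x (ξ x)) x₀

variable {I F}

variable (I F) in
/-- Smoothness of a section of `W` in a neighbourhood of a point. -/
def SmoothNear (s : Π x, W x) (x : B) : Prop := ∀ᶠ y in 𝓝 x, SmoothAt I F s y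

variable (I F) in
/-- Smoothness of a section of `W^∨` in a neighbourhood of a point. -/
def DualSmoothNear (ξ : Π x, W x →L[ℝ] ℝ) (x : B) : Prop := ∀ᶠ y in 𝓝 x, DualSmoothAt I F ξ y

theorem SmoothNear.smoothAt {s : Π x, W x} {x : B} (h : SmoothNear I F s x) : SmoothAt I F s x :=
  Filter.Eventually.self_of_nhds h

theorem DualSmoothNear.dualSmoothAt {s : Π x, W x →L[ℝ] ℝ} {x : B} (h : DualSmoothNear I F s x) :
    DualSmoothAt I F s x :=
  Filter.Eventually.self_of_nhds h

theorem smoothOn_iff {U : Set B} (hU : IsOpen U) {s : Π x, W x} :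
    SmoothOn I F U s ↔ ∀ x ∈ U, SmoothAt I F s x :=
  ⟨fun h _ hx ↦ h.contMDiffAt (hU.mem_nhds hx), fun h _ hx ↦ (h _ hx).contMDiffWithinAt⟩

theorem dualSmoothOn_iff {U : Set B} (hU : IsOpen U) {ξ : Π x, W x →L[ℝ] ℝ} :
    DualSmoothOn I F U ξ ↔ ∀ x ∈ U, DualSmoothAt I F ξ x :=
  ⟨fun h _ hx ↦ ContMDiffOn.contMDiffAt h (hU.mem_nhds hx),
    fun h _ hx ↦ ContMDiffAt.contMDiffWithinAt (h _ hx)⟩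

theorem SmoothOn.near {U : Set B} {s : Π x, W x} (h : SmoothOn I F U s) (hU : IsOpen U) {x : B}
    (hx : x ∈ U) : SmoothNear I F s x :=
  Filter.mem_of_superset (hU.mem_nhds hx) ((smoothOn_iff hU).1 h)

theorem DualSmoothOn.near {U : Set B} {s : Π x, W x →L[ℝ] ℝ} (h : DualSmoothOn I F U s)
    (hU : IsOpen U) {x : B} (hx : x ∈ U) : DualSmoothNear I F s x :=
  Filter.mem_of_superset (hU.mem_nhds hx) ((dualSmoothOn_iff hU).1 h)

theorem SmoothNear.exists_smoothOn {s : Π x, W x} {x : B} (h : SmoothNear I F s x) :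
    ∃ U, IsOpen U ∧ x ∈ U ∧ SmoothOn I F U s := by
  obtain ⟨U, hU, hUo, hx⟩ := mem_nhds_iff.1 h
  exact ⟨U, hUo, hx, (smoothOn_iff hUo).2 hU⟩

theorem SmoothAt.congr {s t : Π x, W x} {x : B} (h : SmoothAt I F s x)
    (hst : ∀ᶠ y in 𝓝 x, t y = s y) : SmoothAt I F t x :=
  ContMDiffAt.congr_of_eventuallyEq h (hst.mono fun y hy ↦ by simp [hy])

theorem SmoothAt.mdifferentiableAt {s : Π x, W x} {x : B} (h : SmoothAt I F s x) :
    MDifferentiableAt I (I.prod 𝓘(ℝ, F)) (fun x ↦ TotalSpace.mk' F x (s x)) x :=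
  ContMDiffAt.mdifferentiableAt h (by simp)

theorem DualSmoothAt.dualMDiffAt {s : Π x, W x →L[ℝ] ℝ} {x : B} (h : DualSmoothAt I F s x) :
    DualMDiffAt I F s x :=
  ContMDiffAt.mdifferentiableAt h (by simp)

theorem DualSmoothAt.apply {ξ : Π x, W x →L[ℝ] ℝ} {x : B} (h : DualSmoothAt I F ξ x)
    {s : Π x, W x} (hs : SmoothAt I F s x) :
    ContMDiffAt I 𝓘(ℝ, ℝ) ∞ (fun y ↦ ξ y (s y)) x := by
  have := ContMDiffAt.clm_bundle_apply (F₁ := F) (F₂ := ℝ)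
    (E₂ := Bundle.Trivial B ℝ) h hs
  exact (contMDiffAt_section (IB := I) (s := fun y ↦ ξ y (s y)) (F := ℝ)
    (E := Bundle.Trivial B ℝ) x).1 this

theorem contMDiffAt_clm_iff [FiniteDimensional ℝ F] {G : Type*} [NormedAddCommGroup G]
    [NormedSpace ℝ G] {f : B → F →L[ℝ] G} {x : B} :
    ContMDiffAt I 𝓘(ℝ, F →L[ℝ] G) ∞ f x ↔
      ∀ c, ContMDiffAt I 𝓘(ℝ, G) ∞ (fun y ↦ f y c) x := by
  constructor
  · intro h c
    exact h.clm_apply contMDiffAt_const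
  · intro h
    let b := Module.finBasis ℝ F
    have : f = fun y ↦ ∑ i, (ContinuousLinearMap.smulRightL ℝ F G
        (LinearMap.toContinuousLinearMap (b.coord i))) (f y (b i)) := by
      ext y c
      conv_lhs => rw [← b.sum_repr c, map_sum]
      simp
    rw [this]
    exact ContMDiffAt.sum fun i _ ↦ contMDiffAt_const.clm_apply (h (b i))

theorem dualSmoothAt_iff_coord [FiniteDimensional ℝ F] [ContMDiffVectorBundle ∞ F W I]
    {ξ : Π x, W x →L[ℝ] ℝ} {x : B} :
    DualSmoothAt I F ξ x ↔ ∀ c : F, ContMDiffAt I 𝓘(ℝ, ℝ) ∞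
      (fun y ↦ ξ y ((trivializationAt F W x).symm y c)) x := by
  set e := trivializationAt F W x
  have hx : x ∈ e.baseSet := mem_baseSet_trivializationAt F W x
  rw [DualSmoothAt, contMDiffAt_hom_bundle, contMDiffAt_clm_iff]
  refine (and_iff_right contMDiffAt_id).trans <| forall_congr' fun c ↦
    Filter.EventuallyEq.contMDiffAt_iff ?_
  filter_upwards [e.open_baseSet.mem_nhds hx] with y hy
  rw [ContinuousLinearMap.inCoordinates_eq hy (by simp)]
  simp [e]

theorem smoothAt_symm [ContMDiffVectorBundle ∞ F W I]
    (e : Trivialization F (TotalSpace.proj : TotalSpace F W → B)) [MemTrivializationAtlas e]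
    {x : B} (hx : x ∈ e.baseSet) (c : F) : SmoothAt I F (fun y ↦ e.symm y c) x := by
  rw [SmoothAt, e.contMDiffAt_section_iff hx]
  refine (contMDiffAt_const (c := c)).congr_of_eventuallyEq ?_
  filter_upwards [e.open_baseSet.mem_nhds hx] with y hy
  simp [e.apply_mk_symm hy]

theorem smoothNear_symm [ContMDiffVectorBundle ∞ F W I]
    (e : Trivialization F (TotalSpace.proj : TotalSpace F W → B)) [MemTrivializationAtlas e]
    {x : B} (hx : x ∈ e.baseSet) (c : F) : SmoothNear I F (fun y ↦ e.symm y c) x :=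
  Filter.mem_of_superset (e.open_baseSet.mem_nhds hx) fun _ hy ↦ smoothAt_symm e hy c

theorem smoothNear_extend [ContMDiffVectorBundle ∞ F W I] {x : B} (v : W x) :
    SmoothNear I F (extend F v) x :=
  smoothNear_symm _ (mem_baseSet_trivializationAt F W x) _

theorem dualSmoothAt_of_forall [FiniteDimensional ℝ F] [ContMDiffVectorBundle ∞ F W I]
    {ξ : Π x, W x →L[ℝ] ℝ} {x : B}
    (h : ∀ s : Π x, W x, SmoothNear I F s x → ContMDiffAt I 𝓘(ℝ, ℝ) ∞ (fun y ↦ ξ y (s y)) x) :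
    DualSmoothAt I F ξ x :=
  dualSmoothAt_iff_coord.2 fun c ↦
    h _ (smoothNear_symm _ (mem_baseSet_trivializationAt F W x) c)

/-- A section of the dual bundle is smooth if its values on a smooth frame are. -/
theorem dualSmoothAt_of_frame [FiniteDimensional ℝ F] [ContMDiffVectorBundle ∞ F W I]
    {ξ : Π x, W x →L[ℝ] ℝ} {x : B} {G : Type*} [NormedAddCommGroup G] [NormedSpace ℝ G]
    [FiniteDimensional ℝ G] (Θ : Π y, G →ₗ[ℝ] W y) (hΘ : Function.Bijective (Θ x))
    (hs : ∀ c, SmoothAt I F (fun y ↦ Θ y c) x)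
    (hξ : ∀ c, ContMDiffAt I 𝓘(ℝ, ℝ) ∞ (fun y ↦ ξ y (Θ y c)) x) : DualSmoothAt I F ξ x := by
  set e := trivializationAt F W x
  have hx : x ∈ e.baseSet := mem_baseSet_trivializationAt F W x
  let T : B → G →L[ℝ] F := fun y ↦
    LinearMap.toContinuousLinearMap ((e.continuousLinearMapAt ℝ y : W y →ₗ[ℝ] F) ∘ₗ Θ y)
  have hT : ContMDiffAt I 𝓘(ℝ, G →L[ℝ] F) ∞ T x := by
    rw [contMDiffAt_clm_iff]
    intro c
    refine ((contMDiffAt_section (IB := I) x).1 (hs c)).congr_of_eventuallyEq ?_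
    filter_upwards [e.open_baseSet.mem_nhds hx] with y hy
    exact congrFun (e.coe_linearMapAt_of_mem (R := ℝ) hy) _
  have hinv : (T x).IsInvertible := by
    refine ⟨(LinearEquiv.ofBijective ((e.continuousLinearMapAt ℝ x : W x →ₗ[ℝ] F) ∘ₗ Θ x)
      ?_).toContinuousLinearEquiv, ?_⟩
    · have : Function.Bijective (e.continuousLinearMapAt ℝ x) := by
        rw [← e.coe_continuousLinearEquivAt_eq hx]
        exact (e.continuousLinearEquivAt ℝ x hx).bijective
      exact this.comp hΘ
    · ext c; rfl
  have : CompleteSpace G := FiniteDimensional.complete ℝ G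
  have hTi : ContMDiffAt I 𝓘(ℝ, F →L[ℝ] G) ∞ (fun y ↦ (T y).inverse) x :=
    (hinv.contDiffAt_map_inverse (n := ∞)).contMDiffAt.comp x hT
  have hev : ∀ᶠ y in 𝓝 x, (T y).IsInvertible := by
    obtain ⟨M, hM⟩ := hinv
    have := hT.continuousAt.eventually_mem (x := x) (s := range ((↑) : (G ≃L[ℝ] F) → G →L[ℝ] F))
      (by rw [← hM]; exact ContinuousLinearEquiv.nhds M)
    exact this
  have hω : ContMDiffAt I 𝓘(ℝ, G →L[ℝ] ℝ) ∞
      (fun y ↦ LinearMap.toContinuousLinearMap ((ξ y : W y →ₗ[ℝ] ℝ) ∘ₗ Θ y)) x :=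
    contMDiffAt_clm_iff.2 hξ
  refine dualSmoothAt_iff_coord.2 fun c ↦ ?_
  have hc : ContMDiffAt I 𝓘(ℝ, F) ∞ (fun _ : B ↦ c) x := contMDiffAt_const
  refine (hω.clm_apply (hTi.clm_apply hc)).congr_of_eventuallyEq ?_
  filter_upwards [hev, e.open_baseSet.mem_nhds hx] with y hy hye
  have h1 : T y ((T y).inverse c) = c := by
    obtain ⟨M, hM⟩ := hy
    simp [← hM]
  have h2 : Θ y ((T y).inverse c) = e.symm y c := by
    have := congrArg (e.symm y) h1
    rw [← this]
    have h3 : T y ((T y).inverse c) = (e ⟨y, Θ y ((T y).inverse c)⟩).2 :=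
      congrFun (e.coe_linearMapAt_of_mem (R := ℝ) hye) _
    rw [h3, e.symm_apply_apply_mk hye]
  exact congrArg (ξ y) h2.symm

end Pointwise

section VectorFields

variable {E : Type*} [NormedAddCommGroup E] [NormedSpace ℝ E] [FiniteDimensional ℝ E]
  {H : Type*} [TopologicalSpace H] {I : ModelWithCorners ℝ E H} [I.Boundaryless]
  {B : Type*} [TopologicalSpace B] [ChartedSpace H B] [IsManifold I ∞ B]

theorem smoothAt_vectorField_iff {A : Π x : B, TangentSpace I x} {x : B} :
    SmoothAt I E A x ↔ ContMDiffAt I 𝓘(ℝ, E) ∞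
      (fun y ↦ mvfderiv I (extChartAt I x) y (A y)) x := by
  rw [SmoothAt, contMDiffAt_section]
  refine Filter.EventuallyEq.contMDiffAt_iff ?_
  filter_upwards [(chartAt H x).open_source.mem_nhds (mem_chart_source H x)] with y hy
  have := congrArg (fun f ↦ f (A y))
    (TangentBundle.continuousLinearMapAt_trivializationAt (I := I) hy)
  refine Eq.trans ?_ this
  rw [Trivialization.continuousLinearMapAt_apply, Trivialization.coe_linearMapAt_of_mem]
  exact hy

theorem ContMDiffAt.mvfderiv_vectorField {G : Type*} [NormedAddCommGroup G] [NormedSpace ℝ G]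
    {f : B → G} {x : B} (hf : ContMDiffAt I 𝓘(ℝ, G) ∞ f x)
    {A : Π x : B, TangentSpace I x} (hA : SmoothAt I E A x) :
    ContMDiffAt I 𝓘(ℝ, G) ∞ (fun y ↦ mvfderiv I f y (A y)) x := by
  have h1 := hf.mfderiv_const (m := ∞) (by simp)
  have h2 : ContMDiffAt I 𝓘(ℝ, G).tangent ∞
      (fun y ↦ (⟨f y, mfderiv I 𝓘(ℝ, G) f y (A y)⟩ : TangentBundle 𝓘(ℝ, G) G)) x :=
    ContMDiffAt.clm_apply_of_inCoordinates h1 hA hf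
  exact ((contMDiff_snd_tangentBundle_modelSpace G 𝓘(ℝ, G)).contMDiffAt).comp x h2

theorem mdifferentiableAt_comp_extChartAt_symm {f : B → ℝ} {x y : B}
    (hy : y ∈ (extChartAt I x).source) (hf : MDifferentiableAt I 𝓘(ℝ, ℝ) f y) :
    DifferentiableAt ℝ (f ∘ (extChartAt I x).symm) (extChartAt I x y) := by
  have h1 : MDifferentiableAt 𝓘(ℝ, E) I (extChartAt I x).symm (extChartAt I x y) := by
    have := mdifferentiableWithinAt_extChartAt_symm (I := I) ((extChartAt I x).map_source hy)
    rwa [I.range_eq_univ, mdifferentiableWithinAt_univ] at this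
  rw [← mdifferentiableAt_iff_differentiableAt]
  refine MDifferentiableAt.comp (I' := I) _ ?_ h1
  rwa [(extChartAt I x).left_inv hy]

theorem mvfderiv_eq_fderiv_comp_symm {f : B → ℝ} {x y : B} (hy : y ∈ (extChartAt I x).source)
    (hf : MDifferentiableAt I 𝓘(ℝ, ℝ) f y) (v : TangentSpace I y) :
    mvfderiv I f y v = fderiv ℝ (f ∘ (extChartAt I x).symm) (extChartAt I x y)
      (mvfderiv I (extChartAt I x) y v) := by
  have hg := mdifferentiableAt_comp_extChartAt_symm hy hf
  have hφ : MDifferentiableAt I 𝓘(ℝ, E) (extChartAt I x) y :=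
    mdifferentiableAt_extChartAt (by simpa using hy)
  have hev : f =ᶠ[𝓝 y] (f ∘ (extChartAt I x).symm) ∘ extChartAt I x := by
    filter_upwards [(isOpen_extChartAt_source x).mem_nhds hy] with z hz
    exact congrArg f ((extChartAt I x).left_inv hz).symm
  have h := mfderiv_comp_apply y (hg.mdifferentiableAt) hφ v
  rw [← hev.mfderiv_eq, mfderiv_eq_fderiv] at h
  exact h

theorem mvfderiv_extChartAt_mlieBracket {x : B} (V W : Π x : B, TangentSpace I x) :
    mvfderiv I (extChartAt I x) x (VectorField.mlieBracket I V W x) =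
      VectorField.lieBracket ℝ
        (fun y ↦ mvfderiv I (extChartAt I x) ((extChartAt I x).symm y)
          (V ((extChartAt I x).symm y)))
        (fun y ↦ mvfderiv I (extChartAt I x) ((extChartAt I x).symm y)
          (W ((extChartAt I x).symm y))) (extChartAt I x x) := by
  have key (V : Π x : B, TangentSpace I x) :
      VectorField.mpullbackWithin 𝓘(ℝ, E) I (extChartAt I x).symm V (range I) =ᶠ[𝓝 (extChartAt I x x)]
      (fun y ↦ mvfderiv I (extChartAt I x) ((extChartAt I x).symm y)
          (V ((extChartAt I x).symm y))) := by
    filter_upwards [(isOpen_extChartAt_target x).mem_nhds (mem_extChartAt_target x)] with y hy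
    rw [VectorField.mpullbackWithin_apply]
    have := ContinuousLinearMap.inverse_eq
      (mfderivWithin_extChartAt_symm_comp_mfderiv_extChartAt (I := I) hy)
      (mfderiv_extChartAt_comp_mfderivWithin_extChartAt_symm hy)
    exact congrArg (fun f ↦ f (V ((extChartAt I x).symm y))) this
  have hinv := isInvertible_mfderiv_extChartAt (I := I) (mem_extChartAt_source (I := I) x)
  rw [← VectorField.mlieBracketWithin_univ, VectorField.mlieBracketWithin_apply, preimage_univ,
    univ_inter]
  refine (DFunLike.congr_fun hinv.self_comp_inverse (VectorField.lieBracketWithin ℝ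
    (VectorField.mpullbackWithin 𝓘(ℝ, E) I (extChartAt I x).symm V (range I))
    (VectorField.mpullbackWithin 𝓘(ℝ, E) I (extChartAt I x).symm W (range I)) (range I)
    (extChartAt I x x))).trans ?_
  simp only [I.range_eq_univ] at key ⊢
  refine (congrFun (VectorField.lieBracketWithin_univ (𝕜 := ℝ)) (extChartAt I x x)).trans ?_
  exact Filter.EventuallyEq.lieBracket_vectorField_eq (𝕜 := ℝ) (key V) (key W)

theorem mvfderiv_mlieBracket {f : B → ℝ} {x : B} (hf : ContMDiffAt I 𝓘(ℝ, ℝ) ∞ f x)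
    {V W : Π x : B, TangentSpace I x} (hV : SmoothAt I E V x) (hW : SmoothAt I E W x) :
    mvfderiv I f x (VectorField.mlieBracket I V W x) =
      mvfderiv I (fun y ↦ mvfderiv I f y (W y)) x (V x)
        - mvfderiv I (fun y ↦ mvfderiv I f y (V y)) x (W x) := by
  have hx := mem_extChartAt_source (I := I) x
  set φ := extChartAt I x with hφ
  set g := f ∘ φ.symm with hg
  have hsymm : ContMDiffAt 𝓘(ℝ, E) I ∞ φ.symm (φ x) :=
    (contMDiffOn_extChartAt_symm x).contMDiffAt
      ((isOpen_extChartAt_target x).mem_nhds (mem_extChartAt_target x))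
  have hxs : φ.symm (φ x) = x := φ.left_inv hx
  have hgs : ContDiffAt ℝ 2 g (φ x) :=
    ((hf.comp_of_eq hsymm hxs).contDiffAt).of_le (by norm_cast)
  have hfd : ∀ᶠ y in 𝓝 (φ x), MDifferentiableAt I 𝓘(ℝ, ℝ) f (φ.symm y) := by
    have h1 : ContMDiffAt I 𝓘(ℝ, ℝ) 1 f x := hf.of_le (by exact_mod_cast le_top)
    have h2 := (contMDiffAt_iff_contMDiffAt_nhds (by simp)).1 h1
    have h3 := hsymm.continuousAt
    rw [ContinuousAt, hxs] at h3
    exact (h3.eventually h2).mono fun y hy ↦ hy.mdifferentiableAt (by simp)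
  have key : ∀ V : Π x : B, TangentSpace I x, (fun y ↦ mvfderiv I f y (V y)) ∘ φ.symm =ᶠ[𝓝 (φ x)]
      fun y ↦ fderiv ℝ g y (mvfderiv I φ (φ.symm y) (V (φ.symm y))) := by
    intro V
    filter_upwards [hfd, (isOpen_extChartAt_target x).mem_nhds (mem_extChartAt_target x)]
      with y hy ht
    have := mvfderiv_eq_fderiv_comp_symm (φ.map_target ht) hy (V (φ.symm y))
    rwa [φ.right_inv ht] at this
  have hd : ∀ V : Π x : B, TangentSpace I x, SmoothAt I E V x →
      DifferentiableAt ℝ (fun y ↦ mvfderiv I φ (φ.symm y) (V (φ.symm y))) (φ x) := by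
    intro V hV
    have h := (smoothAt_vectorField_iff.1 hV).comp_of_eq hsymm hxs
    exact (h.contDiffAt).differentiableAt (by simp)
  have hxW (W : Π x : B, TangentSpace I x) :
      mvfderiv I φ (φ.symm (φ x)) (W (φ.symm (φ x))) = mvfderiv I φ x (W x) :=
    congrArg (fun z ↦ mvfderiv I φ z (W z)) hxs
  have main : ∀ V W : Π x : B, TangentSpace I x, SmoothAt I E V x → SmoothAt I E W x →
      mvfderiv I (fun y ↦ mvfderiv I f y (W y)) x (V x) =
      fderiv ℝ (fderiv ℝ g) (φ x) (mvfderiv I φ x (V x)) (mvfderiv I φ x (W x)) +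
      fderiv ℝ g (φ x) (fderiv ℝ (fun y ↦ mvfderiv I φ (φ.symm y) (W (φ.symm y))) (φ x)
        (mvfderiv I φ x (V x))) := by
    intro V W hV hW
    rw [mvfderiv_eq_fderiv_comp_symm hx
      ((ContMDiffAt.mvfderiv_vectorField hf hW).mdifferentiableAt (by simp)), (key W).fderiv_eq,
      fderiv_clm_apply ((hgs.fderiv_right (m := 1) (by norm_num)).differentiableAt (by simp)) (hd W hW)]
    simp only [add_apply, ContinuousLinearMap.coe_comp, Function.comp_apply,
      ContinuousLinearMap.flip_apply, ← hφ]
    rw [hxW W]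
    exact add_comm _ _
  rw [main V W hV hW, main W V hW hV, mvfderiv_eq_fderiv_comp_symm hx (hf.mdifferentiableAt (by simp)),
    mvfderiv_extChartAt_mlieBracket, VectorField.lieBracket, map_sub, φ.left_inv hx,
    (hgs.isSymmSndFDerivAt (by simp)).eq]
  abel

end VectorFields

section Courant

variable {E : Type*} [NormedAddCommGroup E] [NormedSpace ℝ E] [FiniteDimensional ℝ E]
  {H : Type*} [TopologicalSpace H] {I : ModelWithCorners ℝ E H}
  {B : Type*} [TopologicalSpace B] [ChartedSpace H B] [IsManifold I ∞ B]

theorem lieDer_apply {η : Π x : B, TangentSpace I x →L[ℝ] ℝ} {x : B} (h : DualSmoothAt I E η x)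
    {X Z : Π x : B, TangentSpace I x} (hX : SmoothAt I E X x) (hZ : SmoothAt I E Z x) :
    lieDer I X η x (Z x) = mvfderiv I (fun y ↦ η y (Z y)) x (X x)
      - η x (VectorField.mlieBracket I X Z x) := by
  rw [lieDer, add_apply, extDer_apply I h.dualMDiffAt hX.mdifferentiableAt hZ.mdifferentiableAt]
  ring

/-- Smoothness at a point of a section of `W ⊕ W^∨`, for `W = T`. -/
def GenSmoothAt (a : Π x : B, Gen (TangentSpace I : B → Type _) x) (x : B) : Prop :=
  SmoothAt I E (fun x ↦ (a x).1) x ∧ DualSmoothAt I E (fun x ↦ (a x).2) x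

theorem courant_snd_apply {a b : Π x : B, Gen (TangentSpace I : B → Type _) x} {x : B}
    (ha : GenSmoothAt a x) (hb : GenSmoothAt b x) {Z : Π x : B, TangentSpace I x}
    (hZ : SmoothAt I E Z x) :
    (courant I a b x).2 (Z x) =
      (mvfderiv I (fun y ↦ (b y).2 (Z y)) x (a x).1
        - (b x).2 (VectorField.mlieBracket I (fun y ↦ (a y).1) Z x))
      - (mvfderiv I (fun y ↦ (a y).2 (Z y)) x (b x).1
        - (a x).2 (VectorField.mlieBracket I (fun y ↦ (b y).1) Z x))
      + 1 / 2 * mvfderiv I (fun y ↦ (a y).2 (b y).1 - (b y).2 (a y).1) x (Z x) := by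
  simp only [courant, add_apply, sub_apply, smul_apply, smul_eq_mul]
  rw [lieDer_apply hb.2 ha.1 hZ, lieDer_apply ha.2 hb.1 hZ]

end Courant

section Connection

variable {E : Type*} [NormedAddCommGroup E] [NormedSpace ℝ E] [FiniteDimensional ℝ E]
  {M : Type*} [TopologicalSpace M] [ChartedSpace E M] [IsManifold 𝓘(ℝ, E) ∞ M]
  {F : Type*} [NormedAddCommGroup F] [NormedSpace ℝ F] [FiniteDimensional ℝ F]
  {V : M → Type*} [TopologicalSpace (TotalSpace F V)]
  [∀ x, AddCommGroup (V x)] [∀ x, Module ℝ (V x)] [∀ x, TopologicalSpace (V x)]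
  [∀ x, IsTopologicalAddGroup (V x)] [∀ x, ContinuousSMul ℝ (V x)]
  [FiberBundle F V] [VectorBundle ℝ F V] [ContMDiffVectorBundle ∞ F V 𝓘(ℝ, E)]
  {cov : CovariantDerivative 𝓘(ℝ, E) F V}

theorem cov_congr {s t : Π x, V x} {x : M} (hs : SmoothAt 𝓘(ℝ, E) F s x)
    (ht : SmoothAt 𝓘(ℝ, E) F t x) (hst : ∀ᶠ y in 𝓝 x, s y = t y) : cov s x = cov t x :=
  cov.isCovariantDerivativeOnUniv.congr_of_eventuallyEq hs.mdifferentiableAt ht.mdifferentiableAt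
    Filter.univ_mem hst

theorem cov_smoothAt [T2Space M] (hcov : cov.ContMDiffCovariantDerivative ∞) {s : Π x, V x} {x : M}
    (hs : SmoothNear 𝓘(ℝ, E) F s x) {X : Π x, TangentSpace 𝓘(ℝ, E) x}
    (hX : SmoothAt 𝓘(ℝ, E) E X x) :
    SmoothAt 𝓘(ℝ, E) F (fun y ↦ cov s y (X y)) x := by
  obtain ⟨U, hU, hx, hsU⟩ := hs.exists_smoothOn
  obtain ⟨ψ, -, hψ⟩ := (SmoothBumpFunction.nhds_basis_tsupport (I := 𝓘(ℝ, E)) x).mem_iff.1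
    (hU.mem_nhds hx)
  have h1 : ContMDiff 𝓘(ℝ, E) (𝓘(ℝ, E).prod 𝓘(ℝ, F)) ∞
      (fun y ↦ TotalSpace.mk' F y (((ψ : M → ℝ) • s) y)) :=
    ContMDiffOn.smul_section_of_tsupport ψ.contMDiff.contMDiffOn hU hψ hsU
  have h2 := hcov.contMDiff.contMDiff (σ := (ψ : M → ℝ) • s) (h1.contMDiffOn)
  have h3 : SmoothAt 𝓘(ℝ, E) F (fun y ↦ cov ((ψ : M → ℝ) • s) y (X y)) x :=
    ContMDiffAt.clm_bundle_apply (h2.contMDiffAt Filter.univ_mem) hX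
  refine h3.congr ?_
  filter_upwards [ψ.eventuallyEq_one.eventuallyEq_nhds, hs] with y hy hsy
  have : cov s y = cov ((ψ : M → ℝ) • s) y :=
    cov_congr hsy (h1 y) (hy.mono fun z hz ↦ by simp [hz])
  rw [this]

theorem dualCov_smoothAt [T2Space M] (hcov : cov.ContMDiffCovariantDerivative ∞)
    {ξ : Π x, V x →L[ℝ] ℝ} {x : M} (hξ : DualSmoothNear 𝓘(ℝ, E) F ξ x)
    {X : Π x, TangentSpace 𝓘(ℝ, E) x} (hX : SmoothAt 𝓘(ℝ, E) E X x) :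
    DualSmoothAt 𝓘(ℝ, E) F (fun y ↦ dualCov cov ξ y (X y)) x := by
  refine dualSmoothAt_of_forall fun s hs ↦ ?_
  have h := (ContMDiffAt.mvfderiv_vectorField (hξ.dualSmoothAt.apply hs.smoothAt) hX).sub
    (hξ.dualSmoothAt.apply (cov_smoothAt hcov hs hX))
  refine h.congr_of_eventuallyEq ?_
  filter_upwards [hξ, hs] with y hξy hsy
  exact dualCov_apply cov hξy.dualMDiffAt hsy.mdifferentiableAt (X y)

theorem dualCov_flat [T2Space M] (hcov : cov.ContMDiffCovariantDerivative ∞) (hflat : IsFlat cov)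
    {ξ : Π x, V x →L[ℝ] ℝ} {x : M} (hξ : DualSmoothNear 𝓘(ℝ, E) F ξ x)
    {X Y : Π x, TangentSpace 𝓘(ℝ, E) x} (hX : SmoothNear 𝓘(ℝ, E) E X x)
    (hY : SmoothNear 𝓘(ℝ, E) E Y x) :
    dualCov cov (fun y ↦ dualCov cov ξ y (Y y)) x (X x)
      - dualCov cov (fun y ↦ dualCov cov ξ y (X y)) x (Y x)
      - dualCov cov ξ x (VectorField.mlieBracket 𝓘(ℝ, E) X Y x) = 0 := by
  ext v
  obtain ⟨s, hs, rfl⟩ : ∃ s : Π x, V x, SmoothNear 𝓘(ℝ, E) F s x ∧ s x = v :=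
    ⟨extend F v, smoothNear_extend v, by simp⟩
  have key : ∀ X Y : Π x, TangentSpace 𝓘(ℝ, E) x, SmoothNear 𝓘(ℝ, E) E X x →
      SmoothNear 𝓘(ℝ, E) E Y x →
      dualCov cov (fun y ↦ dualCov cov ξ y (Y y)) x (X x) (s x) =
        mvfderiv 𝓘(ℝ, E) (fun y ↦ mvfderiv 𝓘(ℝ, E) (fun z ↦ ξ z (s z)) y (Y y)) x (X x)
        - mvfderiv 𝓘(ℝ, E) (fun y ↦ ξ y (cov s y (Y y))) x (X x)
        - (mvfderiv 𝓘(ℝ, E) (fun y ↦ ξ y (cov s y (X y))) x (Y x)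
          - ξ x (cov (fun y ↦ cov s y (X y)) x (Y x))) := by
    intro X Y hX hY
    have h1 := ContMDiffAt.mvfderiv_vectorField (hξ.dualSmoothAt.apply hs.smoothAt) hY.smoothAt
    have h2 := hξ.dualSmoothAt.apply (cov_smoothAt hcov hs hY.smoothAt)
    rw [dualCov_apply cov (dualCov_smoothAt hcov hξ hY.smoothAt).dualMDiffAt
        hs.smoothAt.mdifferentiableAt, dualCov_apply cov hξ.dualSmoothAt.dualMDiffAt
        (cov_smoothAt hcov hs hX.smoothAt).mdifferentiableAt]
    congr 1
    rw [← sub_apply, ← mvfderiv_sub (h1.mdifferentiableAt (by simp))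
      (h2.mdifferentiableAt (by simp))]
    have : (fun y ↦ dualCov cov ξ y (Y y) (s y)) =ᶠ[𝓝 x]
      ((fun y ↦ mvfderiv 𝓘(ℝ, E) (fun z ↦ ξ z (s z)) y (Y y)) - fun y ↦ ξ y (cov s y (Y y))) := by
      filter_upwards [hξ, hs] with y hξy hsy
      exact dualCov_apply cov hξy.dualMDiffAt hsy.mdifferentiableAt (Y y)
    simp only [mvfderiv, this.mfderiv_eq]
    rfl
  simp only [sub_apply, zero_apply]
  rw [key X Y hX hY, key Y X hY hX, dualCov_apply cov hξ.dualSmoothAt.dualMDiffAt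
        hs.smoothAt.mdifferentiableAt,
    mvfderiv_mlieBracket (hξ.dualSmoothAt.apply hs.smoothAt) hX.smoothAt hY.smoothAt]
  obtain ⟨U, hU, hUo, hxU⟩ := eventually_nhds_iff.1 ((hs.and hX).and hY)
  have hR := congrArg (ξ x) (hflat U X Y s hUo ((smoothOn_iff hUo).2 fun y hy ↦ (hU y hy).1.2)
    ((smoothOn_iff hUo).2 fun y hy ↦ (hU y hy).2) ((smoothOn_iff hUo).2 fun y hy ↦ (hU y hy).1.1)
    x hxU)
  simp only [map_sub, map_zero] at hR
  linarith

end Connection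

section Deriv

variable {E : Type*} [NormedAddCommGroup E] [NormedSpace ℝ E]
  {H : Type*} [TopologicalSpace H] {I : ModelWithCorners ℝ E H}
  {B : Type*} [TopologicalSpace B] [ChartedSpace H B]
  {E' : Type*} [NormedAddCommGroup E'] [NormedSpace ℝ E']
  {H' : Type*} [TopologicalSpace H'] {I' : ModelWithCorners ℝ E' H'}
  {B' : Type*} [TopologicalSpace B'] [ChartedSpace H' B']
  {E'' : Type*} [NormedAddCommGroup E''] [NormedSpace ℝ E'']
  {H'' : Type*} [TopologicalSpace H''] {I'' : ModelWithCorners ℝ E'' H''}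
  {B'' : Type*} [TopologicalSpace B''] [ChartedSpace H'' B'']
  {G : Type*} [NormedAddCommGroup G] [NormedSpace ℝ G]
  {G' : Type*} [NormedAddCommGroup G'] [NormedSpace ℝ G']

theorem mfderiv_apply_mfderiv {f : B → B'} {g : B' → B''} {a : B} {b : B'} (hb : f a = b)
    (hg : MDifferentiableAt I' I'' g b) (hf : MDifferentiableAt I I' f a) (v : TangentSpace I a) :
    mfderiv I' I'' g b (mfderiv I I' f a v : TangentSpace I' b) = mfderiv I I'' (g ∘ f) a v := by
  subst hb
  exact (mfderiv_comp_apply a hg hf v).symm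

theorem mvfderiv_apply_mfderiv {f : B → B'} {g : B' → G} {a : B} {b : B'} (hb : f a = b)
    (hg : MDifferentiableAt I' 𝓘(ℝ, G) g b) (hf : MDifferentiableAt I I' f a)
    (v : TangentSpace I a) :
    mvfderiv I' g b (mfderiv I I' f a v : TangentSpace I' b) = mvfderiv I (g ∘ f) a v :=
  mfderiv_apply_mfderiv hb hg hf v

theorem mvfderiv_congr {f g : B → G} {x : B} (h : f =ᶠ[𝓝 x] g) (v : TangentSpace I x) :
    mvfderiv I f x v = mvfderiv I g x v :=
  congrArg (fun L : E →L[ℝ] G ↦ L v) h.mfderiv_eq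

theorem mvfderiv_clm_comp (L : G →L[ℝ] G') {f : B → G} {x : B}
    (hf : MDifferentiableAt I 𝓘(ℝ, G) f x) (v : TangentSpace I x) :
    mvfderiv I (fun y ↦ L (f y)) x v = L (mvfderiv I f x v) := by
  have := mfderiv_comp_apply x (L.mdifferentiableAt (x := f x)) hf v
  rw [L.mfderiv_eq] at this
  exact this

end Deriv

section TotalSpace

variable {E : Type*} [NormedAddCommGroup E] [NormedSpace ℝ E] [FiniteDimensional ℝ E]
  {M : Type*} [TopologicalSpace M] [ChartedSpace E M] [IsManifold 𝓘(ℝ, E) ∞ M]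
  {F : Type*} [NormedAddCommGroup F] [NormedSpace ℝ F] [FiniteDimensional ℝ F]
  {V : M → Type*} [TopologicalSpace (TotalSpace F V)]
  [∀ x, AddCommGroup (V x)] [∀ x, Module ℝ (V x)] [∀ x, TopologicalSpace (V x)]
  [∀ x, IsTopologicalAddGroup (V x)] [∀ x, ContinuousSMul ℝ (V x)]
  [FiberBundle F V] [VectorBundle ℝ F V] [ContMDiffVectorBundle ∞ F V 𝓘(ℝ, E)]
  {cov : CovariantDerivative 𝓘(ℝ, E) F V}

variable (E F) in
/-- The model of the total space. -/
abbrev totI : ModelWithCorners ℝ (E × F) (ModelProd E F) := 𝓘(ℝ, E).prod 𝓘(ℝ, F)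

/-- The fibre coordinate of the trivialization `e`. -/
def fibCoord (e : Trivialization F (TotalSpace.proj : TotalSpace F V → M)) (q : TotalSpace F V) :
    F := (e q).2

theorem contMDiffAt_fibCoord (e : Trivialization F (TotalSpace.proj : TotalSpace F V → M))
    [MemTrivializationAtlas e] {q : TotalSpace F V} (hq : q.proj ∈ e.baseSet) :
    ContMDiffAt (totI E F) 𝓘(ℝ, F) ∞ (fibCoord e) q :=
  ((e.contMDiffAt_iff (IB := 𝓘(ℝ, E)) (e.mem_source.2 hq)).1 contMDiffAt_id).2

theorem contMDiffAt_fibre (x : M) (w : F) :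
    ContMDiffAt 𝓘(ℝ, F) (totI E F) ∞
      (fun w : F ↦ TotalSpace.mk' F x ((trivializationAt F V x).symm x w)) w := by
  have hx := mem_baseSet_trivializationAt F V x
  rw [(trivializationAt F V x).contMDiffAt_iff (by simpa [Trivialization.mem_source] using hx)]
  refine ⟨contMDiffAt_const, contMDiffAt_id.congr_of_eventuallyEq (.of_forall fun w ↦ ?_)⟩
  simp [Trivialization.apply_mk_symm _ hx]

theorem mk_symm_fibCoord (p : TotalSpace F V) :
    TotalSpace.mk' F p.proj ((trivializationAt F V p.proj).symm p.proj
      (trivializationAt F V p.proj p).2) = p := by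
  have hx := mem_baseSet_trivializationAt F V p.proj
  conv_rhs => rw [← TotalSpace.eta p]
  congr 1
  exact Trivialization.symm_apply_apply_mk _ hx p.2

theorem mk_extend (p : TotalSpace F V) : TotalSpace.mk' F p.proj (extend F p.2 p.proj) = p := by
  simp

theorem dproj_fibDeriv (p : TotalSpace F V) (c : F) : dproj E p (fibDeriv (E := E) p c) = 0 := by
  refine (mfderiv_apply_mfderiv
    (f := fun w : F ↦ TotalSpace.mk' F p.proj ((trivializationAt F V p.proj).symm p.proj w))
    (mk_symm_fibCoord p)
    ((contMDiffAt_proj V (n := ∞)).mdifferentiableAt (by simp))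
    ((contMDiffAt_fibre p.proj _).mdifferentiableAt (by simp)) c).trans ?_
  have : mfderiv 𝓘(ℝ, F) 𝓘(ℝ, E) (fun _ : F ↦ p.proj) (trivializationAt F V p.proj p).2 = 0 :=
    mfderiv_const
  exact congrArg (fun L : F →L[ℝ] E ↦ L c) this

theorem mvfderiv_fibDeriv {G : Type*} [NormedAddCommGroup G] [NormedSpace ℝ G]
    {p : TotalSpace F V} {h : TotalSpace F V → G}
    (hh : MDifferentiableAt (totI E F) 𝓘(ℝ, G) h p) (c : F) :
    mvfderiv (totI E F) h p (fibDeriv p c) =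
      fderiv ℝ (fun w ↦ h (TotalSpace.mk' F p.proj ((trivializationAt F V p.proj).symm p.proj w)))
        (trivializationAt F V p.proj p).2 c := by
  refine (mvfderiv_apply_mfderiv
    (f := fun w : F ↦ TotalSpace.mk' F p.proj ((trivializationAt F V p.proj).symm p.proj w))
    (mk_symm_fibCoord p) hh
    ((contMDiffAt_fibre p.proj _).mdifferentiableAt (by simp)) c).trans ?_
  rw [mvfderiv, mfderiv_eq_fderiv]
  rfl

theorem mvfderiv_fibCoord_vert (p : TotalSpace F V) (u : V p.proj) :
    mvfderiv (totI E F) (fibCoord (trivializationAt F V p.proj)) p (vert p u) =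
      (trivializationAt F V p.proj).continuousLinearMapAt ℝ p.proj u := by
  have hx := mem_baseSet_trivializationAt F V p.proj
  refine (mvfderiv_fibDeriv ((contMDiffAt_fibCoord _ hx).mdifferentiableAt (by simp)) _).trans ?_
  have : (fun w ↦ fibCoord (trivializationAt F V p.proj)
      (TotalSpace.mk' F p.proj ((trivializationAt F V p.proj).symm p.proj w))) = id := by
    ext w
    simp [fibCoord, Trivialization.apply_mk_symm _ hx]
  rw [this, fderiv_id]
  rfl

theorem dproj_vert (p : TotalSpace F V) (u : V p.proj) : dproj E p (vert p u) = 0 :=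
  dproj_fibDeriv p _

theorem mvfderiv_secDeriv {G : Type*} [NormedAddCommGroup G] [NormedSpace ℝ G]
    {p : TotalSpace F V} {h : TotalSpace F V → G}
    (hh : MDifferentiableAt (totI E F) 𝓘(ℝ, G) h p) (v : TangentSpace 𝓘(ℝ, E) p.proj) :
    mvfderiv (totI E F) h p (secDeriv p v) =
      mvfderiv 𝓘(ℝ, E) (fun x ↦ h (TotalSpace.mk' F x (extend F p.2 x))) p.proj v :=
  mvfderiv_apply_mfderiv (f := fun x ↦ TotalSpace.mk' F x (extend F p.2 x)) (mk_extend p) hh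
    (smoothNear_extend p.2).smoothAt.mdifferentiableAt v

theorem dproj_secDeriv (p : TotalSpace F V) (v : TangentSpace 𝓘(ℝ, E) p.proj) :
    dproj E p (secDeriv p v) = v := by
  refine (mfderiv_apply_mfderiv (f := fun x ↦ TotalSpace.mk' F x (extend F p.2 x)) (mk_extend p)
    ((contMDiffAt_proj V (n := ∞)).mdifferentiableAt (by simp))
    (smoothNear_extend p.2).smoothAt.mdifferentiableAt v).trans ?_
  exact congrArg (fun L : E →L[ℝ] E ↦ L v) (mfderiv_id (I := 𝓘(ℝ, E)) (x := p.proj))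

theorem mvfderiv_fibCoord_secDeriv (p : TotalSpace F V) (v : TangentSpace 𝓘(ℝ, E) p.proj) :
    mvfderiv (totI E F) (fibCoord (trivializationAt F V p.proj)) p (secDeriv p v) = 0 := by
  have hx := mem_baseSet_trivializationAt F V p.proj
  rw [mvfderiv_secDeriv ((contMDiffAt_fibCoord _ hx).mdifferentiableAt (by simp)),
    mvfderiv_congr (g := fun _ ↦ (trivializationAt F V p.proj p).2), mvfderiv_const]
  · rfl
  · filter_upwards [(trivializationAt F V p.proj).open_baseSet.mem_nhds hx] with x hx
    simp [fibCoord, extend, Trivialization.apply_mk_symm _ hx]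

theorem mvfderiv_comp_proj {G : Type*} [NormedAddCommGroup G] [NormedSpace ℝ G]
    {p : TotalSpace F V} {f : M → G} (hf : MDifferentiableAt 𝓘(ℝ, E) 𝓘(ℝ, G) f p.proj)
    (w : TangentSpace (totI E F) p) :
    mvfderiv (totI E F) (fun q : TotalSpace F V ↦ f q.proj) p w =
      mvfderiv 𝓘(ℝ, E) f p.proj (dproj E p w) :=
  (mvfderiv_apply_mfderiv rfl hf
    ((contMDiffAt_proj V (n := ∞)).mdifferentiableAt (by simp)) w).symm

theorem mvfderiv_extChartAt_totalSpace {p q : TotalSpace F V}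
    (hq : q.proj ∈ (trivializationAt F V p.proj).baseSet)
    (hq' : q.proj ∈ (chartAt E p.proj).source) (w : TangentSpace (totI E F) q) :
    mvfderiv (totI E F) (extChartAt (totI E F) p) q w =
      (mvfderiv 𝓘(ℝ, E) (extChartAt 𝓘(ℝ, E) p.proj) q.proj (dproj E q w),
        mvfderiv (totI E F) (fibCoord (trivializationAt F V p.proj)) q w) := by
  set e := trivializationAt F V p.proj
  have hd : MDifferentiableAt (totI E F) 𝓘(ℝ, E × F) (extChartAt (totI E F) p) q := by
    refine mdifferentiableAt_extChartAt ?_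
    rw [FiberBundle.chartedSpace_chartAt]
    simp [e, hq, hq', Trivialization.mem_source]
  have hev : ∀ᶠ z : TotalSpace F V in 𝓝 q, z.proj ∈ e.baseSet :=
    (FiberBundle.continuous_proj F V).continuousAt.eventually (e.open_baseSet.mem_nhds hq)
  ext1
  · have := mvfderiv_clm_comp (ContinuousLinearMap.fst ℝ E F) hd w
    refine this.symm.trans ?_
    rw [← mvfderiv_comp_proj (mdifferentiableAt_extChartAt hq')]
    refine mvfderiv_congr ?_ w
    filter_upwards [hev] with z hz
    rw [FiberBundle.extChartAt]
    simp [e, Trivialization.coe_fst' _ hz]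
  · have := mvfderiv_clm_comp (ContinuousLinearMap.snd ℝ E F) hd w
    refine this.symm.trans ?_
    refine mvfderiv_congr (.of_forall fun z ↦ ?_) w
    rw [FiberBundle.extChartAt]
    simp [e, fibCoord]

theorem eq_zero_of_dproj_of_fibCoord {p : TotalSpace F V} {w : TangentSpace (totI E F) p}
    (h1 : dproj E p w = 0)
    (h2 : mvfderiv (totI E F) (fibCoord (trivializationAt F V p.proj)) p w = 0) : w = 0 := by
  have h := mvfderiv_extChartAt_totalSpace (mem_baseSet_trivializationAt F V p.proj)
    (mem_chart_source E p.proj) w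
  rw [h1, h2, map_zero] at h
  obtain ⟨L, hL⟩ := isInvertible_mfderiv_extChartAt (I := totI E F)
    (mem_extChartAt_source (I := totI E F) p)
  have h' : L w = 0 := by
    rw [← ContinuousLinearEquiv.coe_coe, hL]
    exact h
  exact L.injective (h'.trans (map_zero L).symm)

theorem connProj_vert (cov : CovariantDerivative 𝓘(ℝ, E) F V) (p : TotalSpace F V)
    (u : V p.proj) : connProj cov p (vert p u) = u := by
  have hx := mem_baseSet_trivializationAt F V p.proj
  have h := mvfderiv_fibCoord_vert (E := E) p u
  unfold fibCoord at h
  simp only [connProj, add_apply, ContinuousLinearMap.coe_comp, Function.comp_apply, dproj_vert,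
    map_zero, add_zero, h]
  exact Trivialization.symmL_continuousLinearMapAt _ hx u

theorem connProj_secDeriv (cov : CovariantDerivative 𝓘(ℝ, E) F V) (p : TotalSpace F V)
    (v : TangentSpace 𝓘(ℝ, E) p.proj) :
    connProj cov p (secDeriv p v) = cov (extend F p.2) p.proj v := by
  have h := mvfderiv_fibCoord_secDeriv p v
  unfold fibCoord at h
  simp only [connProj, add_apply, ContinuousLinearMap.coe_comp, Function.comp_apply,
    dproj_secDeriv, map_zero, zero_add, h]

theorem connProj_horLift (cov : CovariantDerivative 𝓘(ℝ, E) F V) (p : TotalSpace F V)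
    (v : TangentSpace 𝓘(ℝ, E) p.proj) : connProj cov p (horLift cov p v) = 0 := by
  simp [horLift, connProj_vert, connProj_secDeriv]

theorem dproj_horLift (cov : CovariantDerivative 𝓘(ℝ, E) F V) (p : TotalSpace F V)
    (v : TangentSpace 𝓘(ℝ, E) p.proj) : dproj E p (horLift cov p v) = v := by
  simp [horLift, dproj_vert, dproj_secDeriv]

theorem vert_connProj_add_horLift_dproj (cov : CovariantDerivative 𝓘(ℝ, E) F V)
    (p : TotalSpace F V) (w : TangentSpace (totI E F) p) :
    vert p (connProj cov p w) + horLift cov p (dproj E p w) = w := by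
  have hx := mem_baseSet_trivializationAt F V p.proj
  rw [← sub_eq_zero]
  refine eq_zero_of_dproj_of_fibCoord ?_ ?_
  · simp [dproj_vert, dproj_horLift]
  · have h : connProj cov p w = (trivializationAt F V p.proj).symmL ℝ p.proj
        (mvfderiv (totI E F) (fibCoord (trivializationAt F V p.proj)) p w)
        + cov (extend F p.2) p.proj (dproj E p w) := rfl
    simp only [horLift, map_sub, map_add, sub_apply, ContinuousLinearMap.coe_comp,
      Function.comp_apply, mvfderiv_fibCoord_vert, mvfderiv_fibCoord_secDeriv, h]
    rw [Trivialization.continuousLinearMapAt_symmL _ hx]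
    abel

theorem eq_zero_of_dproj_of_connProj {p : TotalSpace F V} {w : TangentSpace (totI E F) p}
    (h1 : dproj E p w = 0) (h2 : connProj cov p w = 0) : w = 0 := by
  rw [← vert_connProj_add_horLift_dproj cov p w, h1, h2]
  simp

/-- The function on the total space that a section of the dual bundle defines. -/
def linFun (ξ : Π x, V x →L[ℝ] ℝ) (p : TotalSpace F V) : ℝ := ξ p.proj p.2

theorem contMDiffAt_linFun {ξ : Π x, V x →L[ℝ] ℝ} {p : TotalSpace F V}
    (hξ : DualSmoothAt 𝓘(ℝ, E) F ξ p.proj) :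
    ContMDiffAt (totI E F) 𝓘(ℝ, ℝ) ∞ (linFun (F := F) ξ) p := by
  have h1 : ContMDiffAt (totI E F) (𝓘(ℝ, E).prod 𝓘(ℝ, F →L[ℝ] ℝ)) ∞
      (fun q : TotalSpace F V ↦ TotalSpace.mk' (F →L[ℝ] ℝ)
        (E := fun x ↦ V x →L[ℝ] Bundle.Trivial M ℝ x) q.proj (ξ q.proj)) p :=
    ContMDiffAt.comp p hξ (contMDiffAt_proj V)
  have h2 : ContMDiffAt (totI E F) (totI E F) ∞
      (fun q : TotalSpace F V ↦ TotalSpace.mk' F q.proj q.2) p := contMDiffAt_id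
  have h3 := ContMDiffAt.clm_bundle_apply (F₁ := F) (F₂ := ℝ) (E₂ := Bundle.Trivial M ℝ) h1 h2
  exact (contMDiffAt_totalSpace.1 h3).2

theorem mvfderiv_linFun_vert {ξ : Π x, V x →L[ℝ] ℝ} {p : TotalSpace F V}
    (hξ : DualSmoothAt 𝓘(ℝ, E) F ξ p.proj) (u : V p.proj) :
    mvfderiv (totI E F) (linFun ξ) p (vert p u) = ξ p.proj u := by
  have hx := mem_baseSet_trivializationAt F V p.proj
  refine (mvfderiv_fibDeriv ((contMDiffAt_linFun hξ).mdifferentiableAt (by simp)) _).trans ?_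
  have : (fun w ↦ linFun ξ
      (TotalSpace.mk' F p.proj ((trivializationAt F V p.proj).symm p.proj w))) =
      (ξ p.proj).comp ((trivializationAt F V p.proj).symmL ℝ p.proj) := by
    ext w
    simp [linFun, Trivialization.symmL_apply _ hx]
  rw [this, ContinuousLinearMap.fderiv]
  exact congrArg (ξ p.proj) (Trivialization.symmL_continuousLinearMapAt _ hx u)

theorem mvfderiv_linFun_horLift {ξ : Π x, V x →L[ℝ] ℝ} {p : TotalSpace F V}
    (hξ : DualSmoothAt 𝓘(ℝ, E) F ξ p.proj) (v : TangentSpace 𝓘(ℝ, E) p.proj) :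
    mvfderiv (totI E F) (linFun ξ) p (horLift cov p v) = dualCov cov ξ p.proj v p.2 := by
  have h := dualCov_apply cov hξ.dualMDiffAt
    (smoothNear_extend (I := 𝓘(ℝ, E)) (F := F) p.2).smoothAt.mdifferentiableAt v
  rw [extend_apply_self] at h
  rw [h, horLift, sub_apply, map_sub, ContinuousLinearMap.coe_comp, Function.comp_apply,
    mvfderiv_linFun_vert hξ,
    mvfderiv_secDeriv ((contMDiffAt_linFun hξ).mdifferentiableAt (by simp))]
  rfl

theorem apply_connProj {ξ : Π x, V x →L[ℝ] ℝ} {p : TotalSpace F V}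
    (hξ : DualSmoothAt 𝓘(ℝ, E) F ξ p.proj) (w : TangentSpace (totI E F) p) :
    ξ p.proj (connProj cov p w) =
      mvfderiv (totI E F) (linFun ξ) p w - dualCov cov ξ p.proj (dproj E p w) p.2 := by
  conv_rhs => rw [← vert_connProj_add_horLift_dproj cov p w]
  simp [dproj_vert, dproj_horLift, mvfderiv_linFun_vert hξ, mvfderiv_linFun_horLift hξ]

end TotalSpace

section Separation

variable {E : Type*} [NormedAddCommGroup E] [NormedSpace ℝ E]
  {H : Type*} [TopologicalSpace H] {I : ModelWithCorners ℝ E H}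
  {B : Type*} [TopologicalSpace B] [ChartedSpace H B]
  {F : Type*} [NormedAddCommGroup F] [NormedSpace ℝ F] [FiniteDimensional ℝ F]

theorem contMDiffAt_of_forall_dual {f : B → F} {x : B}
    (h : ∀ l : F →L[ℝ] ℝ, ContMDiffAt I 𝓘(ℝ, ℝ) ∞ (fun y ↦ l (f y)) x) :
    ContMDiffAt I 𝓘(ℝ, F) ∞ f x := by
  let b := Module.finBasis ℝ F
  have : f = fun y ↦ ∑ i, LinearMap.toContinuousLinearMap (b.coord i) (f y) • b i := by
    ext y
    exact (b.sum_repr (f y)).symm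
  rw [this]
  exact ContMDiffAt.sum fun i _ ↦ (h _).smul contMDiffAt_const

theorem eq_of_forall_mvfderiv_eq [FiniteDimensional ℝ E] [IsManifold I ∞ B] {x : B}
    {v w : TangentSpace I x}
    (h : ∀ f : B → ℝ, (∀ᶠ y in 𝓝 x, ContMDiffAt I 𝓘(ℝ, ℝ) ∞ f y) →
      mvfderiv I f x v = mvfderiv I f x w) : v = w := by
  obtain ⟨L, hL⟩ := isInvertible_mfderiv_extChartAt (I := I) (mem_extChartAt_source (I := I) x)
  have hc : ∀ᶠ y in 𝓝 x, ContMDiffAt I 𝓘(ℝ, E) ∞ (extChartAt I x) y := by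
    filter_upwards [(chartAt H x).open_source.mem_nhds (mem_chart_source H x)] with y hy
    exact contMDiffAt_extChartAt' hy
  have h' : mvfderiv I (extChartAt I x) x v = mvfderiv I (extChartAt I x) x w := by
    refine (SeparatingDual.eq_iff_forall_dual_eq (R := ℝ)).2 fun l ↦ ?_
    have hd := hc.self_of_nhds.mdifferentiableAt (by simp)
    rw [← mvfderiv_clm_comp l hd, ← mvfderiv_clm_comp l hd]
    exact h _ (hc.mono fun y hy ↦ l.contMDiff.contMDiffAt.comp y hy)
  refine L.injective ?_
  rw [← ContinuousLinearEquiv.coe_coe, hL]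
  exact h'

end Separation

section TotalSpace

variable {E : Type*} [NormedAddCommGroup E] [NormedSpace ℝ E] [FiniteDimensional ℝ E]
  {M : Type*} [TopologicalSpace M] [ChartedSpace E M] [IsManifold 𝓘(ℝ, E) ∞ M]
  {F : Type*} [NormedAddCommGroup F] [NormedSpace ℝ F] [FiniteDimensional ℝ F]
  {V : M → Type*} [TopologicalSpace (TotalSpace F V)]
  [∀ x, AddCommGroup (V x)] [∀ x, Module ℝ (V x)] [∀ x, TopologicalSpace (V x)]
  [∀ x, IsTopologicalAddGroup (V x)] [∀ x, ContinuousSMul ℝ (V x)]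
  [FiberBundle F V] [VectorBundle ℝ F V] [ContMDiffVectorBundle ∞ F V 𝓘(ℝ, E)]
  {cov : CovariantDerivative 𝓘(ℝ, E) F V}

/-- The section of `V^∨` with constant coordinates `l` in the trivialization `e`. -/
def coordForm (e : Trivialization F (TotalSpace.proj : TotalSpace F V → M))
    [MemTrivializationAtlas e] (l : F →L[ℝ] ℝ) (x : M) : V x →L[ℝ] ℝ :=
  l.comp (e.continuousLinearMapAt ℝ x)

theorem coordForm_apply (e : Trivialization F (TotalSpace.proj : TotalSpace F V → M))
    [MemTrivializationAtlas e] (l : F →L[ℝ] ℝ) {x : M} (hx : x ∈ e.baseSet) (v : V x) :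
    coordForm e l x v = l (e ⟨x, v⟩).2 :=
  congrArg l (congrFun (e.coe_linearMapAt_of_mem (R := ℝ) hx) v)

theorem dualSmoothAt_coordForm (e : Trivialization F (TotalSpace.proj : TotalSpace F V → M))
    [MemTrivializationAtlas e] (l : F →L[ℝ] ℝ) {x : M} (hx : x ∈ e.baseSet) :
    DualSmoothAt 𝓘(ℝ, E) F (coordForm e l) x := by
  refine dualSmoothAt_of_forall fun s hs ↦ ?_
  have h := l.contMDiff.contMDiffAt.comp x ((e.contMDiffAt_section_iff hx).1 hs.smoothAt)
  refine h.congr_of_eventuallyEq ?_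
  filter_upwards [e.open_baseSet.mem_nhds hx] with y hy
  exact coordForm_apply e l hy _

theorem dualSmoothNear_coordForm (e : Trivialization F (TotalSpace.proj : TotalSpace F V → M))
    [MemTrivializationAtlas e] (l : F →L[ℝ] ℝ) {x : M} (hx : x ∈ e.baseSet) :
    DualSmoothNear 𝓘(ℝ, E) F (coordForm e l) x :=
  Filter.mem_of_superset (e.open_baseSet.mem_nhds hx) fun _ hy ↦ dualSmoothAt_coordForm e l hy

theorem eq_zero_of_forall_dual {x : M} {v : V x}
    (h : ∀ ξ : Π x, V x →L[ℝ] ℝ, DualSmoothNear 𝓘(ℝ, E) F ξ x → ξ x v = 0) : v = 0 := by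
  have hx := mem_baseSet_trivializationAt F V x
  have h0 : (trivializationAt F V x).continuousLinearMapAt ℝ x v = 0 :=
    SeparatingDual.eq_zero_of_forall_dual_eq_zero (R := ℝ) fun l ↦
      h _ (dualSmoothNear_coordForm _ l hx)
  rw [← Trivialization.symmL_continuousLinearMapAt (R := ℝ) _ hx v, h0, map_zero]

theorem eventually_proj {p : TotalSpace F V} {P : M → Prop} (h : ∀ᶠ x in 𝓝 p.proj, P x) :
    ∀ᶠ q : TotalSpace F V in 𝓝 p, P q.proj :=
  (FiberBundle.continuous_proj F V).continuousAt.eventually h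

theorem contMDiffAt_comp_proj {G : Type*} [NormedAddCommGroup G] [NormedSpace ℝ G]
    {p : TotalSpace F V} {f : M → G} (hf : ContMDiffAt 𝓘(ℝ, E) 𝓘(ℝ, G) ∞ f p.proj) :
    ContMDiffAt (totI E F) 𝓘(ℝ, G) ∞ (fun q : TotalSpace F V ↦ f q.proj) p :=
  ContMDiffAt.comp p hf (contMDiffAt_proj V)

/-- A vector field on the total space is smooth if its components are. -/
theorem smoothAt_of_dproj_of_linFun {A : Π p : TotalSpace F V, TangentSpace (totI E F) p}
    {p : TotalSpace F V}
    (h1 : ContMDiffAt (totI E F) 𝓘(ℝ, E) ∞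
      (fun q ↦ mvfderiv 𝓘(ℝ, E) (extChartAt 𝓘(ℝ, E) p.proj) q.proj (dproj E q (A q))) p)
    (h2 : ∀ ξ : Π x, V x →L[ℝ] ℝ, DualSmoothNear 𝓘(ℝ, E) F ξ p.proj →
      ContMDiffAt (totI E F) 𝓘(ℝ, ℝ) ∞ (fun q ↦ mvfderiv (totI E F) (linFun ξ) q (A q)) p) :
    SmoothAt (totI E F) (E × F) A p := by
  set e := trivializationAt F V p.proj
  have hp : p.proj ∈ e.baseSet := mem_baseSet_trivializationAt F V p.proj
  have h3 : ContMDiffAt (totI E F) 𝓘(ℝ, F) ∞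
      (fun q ↦ mvfderiv (totI E F) (fibCoord e) q (A q)) p := by
    refine contMDiffAt_of_forall_dual fun l ↦
      (h2 _ (dualSmoothNear_coordForm e l hp)).congr_of_eventuallyEq ?_
    filter_upwards [eventually_proj (e.open_baseSet.mem_nhds hp)] with q hq
    rw [← mvfderiv_clm_comp l ((contMDiffAt_fibCoord e hq).mdifferentiableAt (by simp))]
    refine mvfderiv_congr ?_ (A q)
    filter_upwards [eventually_proj (e.open_baseSet.mem_nhds hq)] with z hz
    exact (coordForm_apply e l hz z.2).symm
  refine smoothAt_vectorField_iff.2 ((h1.prodMk_space h3).congr_of_eventuallyEq ?_)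
  filter_upwards [eventually_proj (e.open_baseSet.mem_nhds hp),
    eventually_proj ((chartAt E p.proj).open_source.mem_nhds (mem_chart_source E p.proj))]
    with q hq hq'
  exact mvfderiv_extChartAt_totalSpace hq hq' (A q)

/-- The vertical vector field on the total space defined by a section of `V`. -/
def vertField (s : Π x, V x) (p : TotalSpace F V) : TangentSpace (totI E F) p :=
  vert p (s p.proj)

variable (cov) in
/-- The horizontal lift of a vector field. -/
def horField (Y : Π x : M, TangentSpace 𝓘(ℝ, E) x) (p : TotalSpace F V) :
    TangentSpace (totI E F) p :=
  horLift cov p (Y p.proj)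

variable (cov) in
/-- The one-form on the total space defined by a section of `V^∨` and the connection. -/
def connForm (ξ : Π x, V x →L[ℝ] ℝ) (p : TotalSpace F V) : TangentSpace (totI E F) p →L[ℝ] ℝ :=
  (ξ p.proj).comp (connProj cov p)

/-- The pull-back of a one-form to the total space. -/
def projForm (η : Π x : M, TangentSpace 𝓘(ℝ, E) x →L[ℝ] ℝ) (p : TotalSpace F V) :
    TangentSpace (totI E F) p →L[ℝ] ℝ :=
  (η p.proj).comp (dproj E p)

theorem smoothAt_vertField {s : Π x, V x} {p : TotalSpace F V}
    (hs : SmoothAt 𝓘(ℝ, E) F s p.proj) :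
    SmoothAt (totI E F) (E × F) (vertField (E := E) s) p := by
  refine smoothAt_of_dproj_of_linFun ?_ fun ξ hξ ↦ ?_
  · simp only [vertField, dproj_vert, map_zero]
    exact contMDiffAt_const
  · refine (contMDiffAt_comp_proj (hξ.dualSmoothAt.apply hs)).congr_of_eventuallyEq ?_
    filter_upwards [eventually_proj hξ] with q hq
    exact mvfderiv_linFun_vert hq _

theorem smoothAt_horField [T2Space M] (hcov : cov.ContMDiffCovariantDerivative ∞)
    {Y : Π x : M, TangentSpace 𝓘(ℝ, E) x} {p : TotalSpace F V}
    (hY : SmoothAt 𝓘(ℝ, E) E Y p.proj) :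
    SmoothAt (totI E F) (E × F) (horField cov Y) p := by
  refine smoothAt_of_dproj_of_linFun ?_ fun ξ hξ ↦ ?_
  · simp only [horField, dproj_horLift]
    exact contMDiffAt_comp_proj (smoothAt_vectorField_iff.1 hY)
  · refine (contMDiffAt_linFun (dualCov_smoothAt hcov hξ hY)).congr_of_eventuallyEq ?_
    filter_upwards [eventually_proj hξ] with q hq
    exact mvfderiv_linFun_horLift hq _

theorem dualSmoothAt_of_vert_of_hor [T2Space M] (hcov : cov.ContMDiffCovariantDerivative ∞)
    {φ : Π p : TotalSpace F V, TangentSpace (totI E F) p →L[ℝ] ℝ} {p : TotalSpace F V}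
    (h1 : ∀ s : Π x, V x, SmoothNear 𝓘(ℝ, E) F s p.proj →
      ContMDiffAt (totI E F) 𝓘(ℝ, ℝ) ∞ (fun q ↦ φ q (vertField s q)) p)
    (h2 : ∀ Y : Π x : M, TangentSpace 𝓘(ℝ, E) x, SmoothNear 𝓘(ℝ, E) E Y p.proj →
      ContMDiffAt (totI E F) 𝓘(ℝ, ℝ) ∞ (fun q ↦ φ q (horField cov Y q)) p) :
    DualSmoothAt (totI E F) (E × F) φ p := by
  set e := trivializationAt F V p.proj
  set t := trivializationAt E (TangentSpace 𝓘(ℝ, E) : M → Type _) p.proj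
  have he : p.proj ∈ e.baseSet := mem_baseSet_trivializationAt F V p.proj
  have ht : p.proj ∈ t.baseSet := mem_baseSet_trivializationAt E _ p.proj
  have hse (c : F) : SmoothNear 𝓘(ℝ, E) F (fun x ↦ e.symmL ℝ x c) p.proj := by
    filter_upwards [e.open_baseSet.mem_nhds he] with x hx
    refine (smoothAt_symm e hx c).congr ?_
    filter_upwards [e.open_baseSet.mem_nhds hx] with y hy
    exact e.symmL_apply hy c
  have hst (c : E) : SmoothNear 𝓘(ℝ, E) E (fun x ↦ t.symmL ℝ x c) p.proj := by
    filter_upwards [t.open_baseSet.mem_nhds ht] with x hx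
    refine (smoothAt_symm t hx c).congr ?_
    filter_upwards [t.open_baseSet.mem_nhds hx] with y hy
    exact t.symmL_apply hy c
  let Θ (q : TotalSpace F V) : (F × E) →ₗ[ℝ] TangentSpace (totI E F) q :=
    LinearMap.coprod ((vert q ∘L e.symmL ℝ q.proj : F →L[ℝ] TangentSpace (totI E F) q) :
        F →ₗ[ℝ] TangentSpace (totI E F) q)
      ((horLift cov q ∘L t.symmL ℝ q.proj : E →L[ℝ] TangentSpace (totI E F) q) :
        E →ₗ[ℝ] TangentSpace (totI E F) q)
  refine dualSmoothAt_of_frame Θ ?_ (fun c ↦ ?_) (fun c ↦ ?_)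
  · rw [Function.bijective_iff_has_inverse]
    refine ⟨fun w ↦ (e.continuousLinearMapAt ℝ p.proj (connProj cov p w),
      t.continuousLinearMapAt ℝ p.proj (dproj E p w)), fun c ↦ ?_, fun w ↦ ?_⟩
    · simp only [Θ, LinearMap.coprod_apply, ContinuousLinearMap.coe_coe,
        ContinuousLinearMap.coe_comp, Function.comp_apply, map_add, connProj_vert,
        connProj_horLift, dproj_vert, dproj_horLift, add_zero, zero_add]
      rw [e.continuousLinearMapAt_symmL he, t.continuousLinearMapAt_symmL ht]
    · simp only [Θ, LinearMap.coprod_apply, ContinuousLinearMap.coe_coe,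
        ContinuousLinearMap.coe_comp, Function.comp_apply]
      rw [e.symmL_continuousLinearMapAt he, t.symmL_continuousLinearMapAt ht,
        vert_connProj_add_horLift_dproj]
  · exact ContMDiffAt.add_section (smoothAt_vertField (hse c.1).smoothAt)
      (smoothAt_horField hcov (hst c.2).smoothAt)
  · refine ((h1 _ (hse c.1)).add (h2 _ (hst c.2))).congr_of_eventuallyEq (.of_forall fun q ↦ ?_)
    exact map_add (φ q) _ _

theorem dualSmoothAt_connForm [T2Space M] (hcov : cov.ContMDiffCovariantDerivative ∞)
    {ξ : Π x, V x →L[ℝ] ℝ} {p : TotalSpace F V} (hξ : DualSmoothAt 𝓘(ℝ, E) F ξ p.proj) :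
    DualSmoothAt (totI E F) (E × F) (connForm cov ξ) p := by
  refine dualSmoothAt_of_vert_of_hor hcov (fun s hs ↦ ?_) (fun Y hY ↦ ?_)
  · simp only [connForm, vertField, ContinuousLinearMap.coe_comp, Function.comp_apply,
      connProj_vert]
    exact contMDiffAt_comp_proj (hξ.apply hs.smoothAt)
  · simp only [connForm, horField, ContinuousLinearMap.coe_comp, Function.comp_apply,
      connProj_horLift, map_zero]
    exact contMDiffAt_const

theorem dualSmoothAt_projForm [T2Space M] (hcov : cov.ContMDiffCovariantDerivative ∞)
    {η : Π x : M, TangentSpace 𝓘(ℝ, E) x →L[ℝ] ℝ} {p : TotalSpace F V}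
    (hη : DualSmoothAt 𝓘(ℝ, E) E η p.proj) :
    DualSmoothAt (totI E F) (E × F) (projForm (F := F) (V := V) η) p := by
  refine dualSmoothAt_of_vert_of_hor hcov (fun s hs ↦ ?_) (fun Y hY ↦ ?_)
  · simp only [projForm, vertField, ContinuousLinearMap.coe_comp, Function.comp_apply,
      dproj_vert, map_zero]
    exact contMDiffAt_const
  · simp only [projForm, horField, ContinuousLinearMap.coe_comp, Function.comp_apply,
      dproj_horLift]
    exact contMDiffAt_comp_proj (hη.apply hY.smoothAt)

/-! ### Brackets of lifted vector fields -/

theorem dproj_mlieBracket {A A' : Π p : TotalSpace F V, TangentSpace (totI E F) p}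
    {Y Y' : Π x : M, TangentSpace 𝓘(ℝ, E) x} {p : TotalSpace F V}
    (hA : SmoothAt (totI E F) (E × F) A p) (hA' : SmoothAt (totI E F) (E × F) A' p)
    (hY : SmoothAt 𝓘(ℝ, E) E Y p.proj) (hY' : SmoothAt 𝓘(ℝ, E) E Y' p.proj)
    (h : ∀ q, dproj E q (A q) = Y q.proj) (h' : ∀ q, dproj E q (A' q) = Y' q.proj) :
    dproj E p (VectorField.mlieBracket (totI E F) A A' p) =
      VectorField.mlieBracket 𝓘(ℝ, E) Y Y' p.proj := by
  refine eq_of_forall_mvfderiv_eq (I := 𝓘(ℝ, E)) fun f hf ↦ ?_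
  have hfp := hf.self_of_nhds
  have key {A A' : Π p : TotalSpace F V, TangentSpace (totI E F) p}
      {Y Y' : Π x : M, TangentSpace 𝓘(ℝ, E) x} (hY : SmoothAt 𝓘(ℝ, E) E Y p.proj)
      (h : ∀ q, dproj E q (A q) = Y q.proj) (h' : ∀ q, dproj E q (A' q) = Y' q.proj) :
      mvfderiv (totI E F) (fun q ↦ mvfderiv (totI E F)
        (fun q : TotalSpace F V ↦ f q.proj) q (A q)) p (A' p) =
      mvfderiv 𝓘(ℝ, E) (fun x ↦ mvfderiv 𝓘(ℝ, E) f x (Y x)) p.proj (Y' p.proj) := by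
    rw [← h', ← mvfderiv_comp_proj
      ((ContMDiffAt.mvfderiv_vectorField hfp hY).mdifferentiableAt (by simp))]
    refine mvfderiv_congr ?_ _
    filter_upwards [eventually_proj hf] with q hq
    rw [mvfderiv_comp_proj (hq.mdifferentiableAt (by simp)), h]
  rw [← mvfderiv_comp_proj (hfp.mdifferentiableAt (by simp)),
    mvfderiv_mlieBracket (contMDiffAt_comp_proj hfp) hA hA', mvfderiv_mlieBracket hfp hY hY',
    key hY' h' h, key hY h h']

theorem connProj_eq_zero {p : TotalSpace F V} {w : TangentSpace (totI E F) p}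
    (h : ∀ ξ : Π x, V x →L[ℝ] ℝ, DualSmoothNear 𝓘(ℝ, E) F ξ p.proj →
      mvfderiv (totI E F) (linFun ξ) p w = dualCov cov ξ p.proj (dproj E p w) p.2) :
    connProj cov p w = 0 := by
  refine eq_zero_of_forall_dual (E := E) (F := F) fun ξ hξ ↦ ?_
  rw [apply_connProj hξ.dualSmoothAt, h ξ hξ, sub_self]

theorem smoothAt_zero (x : M) : SmoothAt 𝓘(ℝ, E) E (fun y : M ↦ (0 : TangentSpace 𝓘(ℝ, E) y)) x :=
  (contMDiff_zeroSection ℝ (TangentSpace 𝓘(ℝ, E) : M → Type _)).contMDiffAt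

theorem dproj_mlieBracket_horField_vertField [T2Space M]
    (hcov : cov.ContMDiffCovariantDerivative ∞)
    {Y : Π x : M, TangentSpace 𝓘(ℝ, E) x} {s : Π x, V x} {p : TotalSpace F V}
    (hY : SmoothAt 𝓘(ℝ, E) E Y p.proj) (hs : SmoothAt 𝓘(ℝ, E) F s p.proj) :
    dproj E p (VectorField.mlieBracket (totI E F) (horField cov Y) (vertField s) p) = 0 := by
  rw [dproj_mlieBracket (smoothAt_horField hcov hY) (smoothAt_vertField hs) hY (smoothAt_zero _)
    (fun q ↦ dproj_horLift cov q _) (fun q ↦ dproj_vert q _)]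
  exact congrFun (VectorField.mlieBracket_zero_right (I := 𝓘(ℝ, E)) (W := Y)) p.proj

theorem dproj_mlieBracket_horField [T2Space M] (hcov : cov.ContMDiffCovariantDerivative ∞)
    {Y Z : Π x : M, TangentSpace 𝓘(ℝ, E) x} {p : TotalSpace F V}
    (hY : SmoothAt 𝓘(ℝ, E) E Y p.proj) (hZ : SmoothAt 𝓘(ℝ, E) E Z p.proj) :
    dproj E p (VectorField.mlieBracket (totI E F) (horField cov Y) (horField cov Z) p) =
      VectorField.mlieBracket 𝓘(ℝ, E) Y Z p.proj :=
  dproj_mlieBracket (smoothAt_horField hcov hY) (smoothAt_horField hcov hZ) hY hZ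
    (fun q ↦ dproj_horLift cov q _) (fun q ↦ dproj_horLift cov q _)

theorem mlieBracket_vertField {s t : Π x, V x} {p : TotalSpace F V}
    (hs : SmoothAt 𝓘(ℝ, E) F s p.proj) (ht : SmoothAt 𝓘(ℝ, E) F t p.proj)
    (cov : CovariantDerivative 𝓘(ℝ, E) F V) :
    VectorField.mlieBracket (totI E F) (vertField s) (vertField t) p = 0 := by
  have h0 : dproj E p (VectorField.mlieBracket (totI E F) (vertField s) (vertField t) p) = 0 := by
    rw [dproj_mlieBracket (smoothAt_vertField hs) (smoothAt_vertField ht) (smoothAt_zero _)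
      (smoothAt_zero _) (fun q ↦ dproj_vert q _) (fun q ↦ dproj_vert q _)]
    exact congrFun (VectorField.mlieBracket_zero_right (I := 𝓘(ℝ, E))) p.proj
  refine eq_zero_of_dproj_of_connProj (cov := cov) h0 (connProj_eq_zero fun ξ hξ ↦ ?_)
  have key {s t : Π x, V x} (ht : SmoothAt 𝓘(ℝ, E) F t p.proj) :
      mvfderiv (totI E F) (fun q ↦ mvfderiv (totI E F) (linFun ξ) q (vertField t q)) p
        (vertField s p) = 0 := by
    rw [mvfderiv_congr (g := fun q ↦ ξ q.proj (t q.proj)),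
      mvfderiv_comp_proj ((hξ.dualSmoothAt.apply ht).mdifferentiableAt (by simp)),
      vertField, dproj_vert, map_zero]
    filter_upwards [eventually_proj hξ] with q hq
    exact mvfderiv_linFun_vert hq _
  rw [h0, mvfderiv_mlieBracket (contMDiffAt_linFun hξ.dualSmoothAt) (smoothAt_vertField hs)
    (smoothAt_vertField ht), key ht, key hs]
  simp

theorem connProj_mlieBracket_horField [T2Space M] (hcov : cov.ContMDiffCovariantDerivative ∞)
    {Y Z : Π x : M, TangentSpace 𝓘(ℝ, E) x} {p : TotalSpace F V} (hp : p.2 = 0)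
    (hY : SmoothNear 𝓘(ℝ, E) E Y p.proj) (hZ : SmoothNear 𝓘(ℝ, E) E Z p.proj) :
    connProj cov p (VectorField.mlieBracket (totI E F) (horField cov Y) (horField cov Z) p) = 0 := by
  refine connProj_eq_zero fun ξ hξ ↦ ?_
  have key {Y Z : Π x : M, TangentSpace 𝓘(ℝ, E) x} (hY : SmoothNear 𝓘(ℝ, E) E Y p.proj) :
      mvfderiv (totI E F) (fun q ↦ mvfderiv (totI E F) (linFun ξ) q (horField cov Y q)) p
        (horField cov Z p) = 0 := by
    rw [mvfderiv_congr (g := linFun fun x ↦ dualCov cov ξ x (Y x)), horField,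
      mvfderiv_linFun_horLift (dualCov_smoothAt hcov hξ hY.smoothAt), hp, map_zero]
    filter_upwards [eventually_proj hξ] with q hq
    exact mvfderiv_linFun_horLift hq _
  rw [mvfderiv_mlieBracket (contMDiffAt_linFun hξ.dualSmoothAt) (smoothAt_horField hcov hY.smoothAt)
    (smoothAt_horField hcov hZ.smoothAt), key hY, key hZ, hp, map_zero, sub_zero]

end TotalSpace

section CourantSwap

variable {E : Type*} [NormedAddCommGroup E] [NormedSpace ℝ E] [FiniteDimensional ℝ E]
  {H : Type*} [TopologicalSpace H] {I : ModelWithCorners ℝ E H}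
  {B : Type*} [TopologicalSpace B] [ChartedSpace H B] [IsManifold I ∞ B]

theorem courant_fst (a b : Π x : B, Gen (TangentSpace I : B → Type _) x) (x : B) :
    (courant I a b x).1 =
      VectorField.mlieBracket I (fun y ↦ (a y).1) (fun y ↦ (b y).1) x := rfl

theorem courant_swap (a b : Π x : B, Gen (TangentSpace I : B → Type _) x) (x : B) :
    courant I b a x = -courant I a b x := by
  refine Prod.ext (VectorField.mlieBracket_swap_apply ..) ?_
  have h : (fun y ↦ (b y).2 (a y).1 - (a y).2 (b y).1) =
      -fun y ↦ (a y).2 (b y).1 - (b y).2 (a y).1 := by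
    ext y
    simp
  simp only [courant, Prod.snd_neg, h, mvfderiv_neg, smul_neg]
  abel

end CourantSwap

section ConstZero

variable {E : Type*} [NormedAddCommGroup E] [NormedSpace ℝ E]
  {H : Type*} [TopologicalSpace H] {I : ModelWithCorners ℝ E H}
  {B : Type*} [TopologicalSpace B] [ChartedSpace H B]

theorem mvfderiv_zero_apply {x : B} (v : TangentSpace I x) :
    mvfderiv I (fun _ : B ↦ (0 : ℝ)) x v = 0 := by
  rw [mvfderiv_const]
  rfl

end ConstZero

section Lifts

variable {E : Type*} [NormedAddCommGroup E] [NormedSpace ℝ E] [FiniteDimensional ℝ E]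
  {M : Type*} [TopologicalSpace M] [ChartedSpace E M] [IsManifold 𝓘(ℝ, E) ∞ M]
  {F : Type*} [NormedAddCommGroup F] [NormedSpace ℝ F] [FiniteDimensional ℝ F]
  {V : M → Type*} [TopologicalSpace (TotalSpace F V)]
  [∀ x, AddCommGroup (V x)] [∀ x, Module ℝ (V x)] [∀ x, TopologicalSpace (V x)]
  [∀ x, IsTopologicalAddGroup (V x)] [∀ x, ContinuousSMul ℝ (V x)]
  [FiberBundle F V] [VectorBundle ℝ F V] [ContMDiffVectorBundle ∞ F V 𝓘(ℝ, E)]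
  {cov : CovariantDerivative 𝓘(ℝ, E) F V}

theorem splitF_eq_inclT {p : TotalSpace F V}
    {K : Gen (TangentSpace (totI E F) : TotalSpace F V → Type _) p}
    {b : Gen (TangentSpace 𝓘(ℝ, E) : M → Type _) p.proj}
    (h1 : connProj cov p K.1 = 0) (h2 : dproj E p K.1 = b.1) (h3 : ∀ u, K.2 (vert p u) = 0)
    (h4 : ∀ v, K.2 (horLift cov p v) = b.2 v) : splitF cov p K = inclT p.proj b := by
  refine Prod.ext (Prod.ext h1 h2) ?_
  ext v
  · exact (congrArg K.2 (by simp)).trans ((h3 v).trans (by simp [inclT]))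
  · exact (congrArg K.2 (by simp)).trans ((h4 v).trans (by simp [inclT]))

theorem splitF_eq_inclV {p : TotalSpace F V}
    {K : Gen (TangentSpace (totI E F) : TotalSpace F V → Type _) p}
    (h2 : dproj E p K.1 = 0) (h4 : ∀ v, K.2 (horLift cov p v) = 0) :
    splitF cov p K = inclV p.proj (connProj cov p K.1, K.2.comp (vert p)) := by
  refine Prod.ext (Prod.ext rfl h2) ?_
  ext v
  · exact congrArg K.2 (by simp)
  · exact (congrArg K.2 (by simp)).trans ((h4 v).trans (by simp [inclV]))

theorem eq_zero_of_vert_of_horLift {p : TotalSpace F V}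
    {φ : TangentSpace (totI E F) p →L[ℝ] ℝ} (h1 : ∀ u, φ (vert p u) = 0)
    (h2 : ∀ v, φ (horLift cov p v) = 0) : φ = 0 := by
  ext w
  rw [← vert_connProj_add_horLift_dproj cov p w, map_add, h1, h2]
  simp

theorem exists_smoothNear_eq {x : M} (u : V x) :
    ∃ s : Π x, V x, SmoothNear 𝓘(ℝ, E) F s x ∧ s x = u :=
  ⟨extend F u, smoothNear_extend u, by simp⟩

theorem exists_smoothNear_vectorField_eq {x : M} (v : TangentSpace 𝓘(ℝ, E) x) :
    ∃ Z : Π x : M, TangentSpace 𝓘(ℝ, E) x, SmoothNear 𝓘(ℝ, E) E Z x ∧ Z x = v :=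
  ⟨extend E v, smoothNear_extend v, by simp⟩

variable (cov) in
/-- The lift to the total space of a section of `T_M ⊕ T_M^∨`. -/
def liftT (A : Π x : M, Gen (TangentSpace 𝓘(ℝ, E) : M → Type _) x) (p : TotalSpace F V) :
    Gen (TangentSpace (totI E F) : TotalSpace F V → Type _) p :=
  (horField cov (fun x ↦ (A x).1) p, projForm (fun x ↦ (A x).2) p)

theorem liftT_fst (A : Π x : M, Gen (TangentSpace 𝓘(ℝ, E) : M → Type _) x) :
    (fun p : TotalSpace F V ↦ (liftT cov A p).1) = horField cov fun x ↦ (A x).1 := rfl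

/-- The lift to the total space of a section of `V`. -/
def liftV (s : Π x, V x) (p : TotalSpace F V) :
    Gen (TangentSpace (totI E F) : TotalSpace F V → Type _) p :=
  (vertField s p, 0)

variable (cov) in
/-- The lift to the total space of a section of `V^∨`. -/
def liftVd (ξ : Π x, V x →L[ℝ] ℝ) (p : TotalSpace F V) :
    Gen (TangentSpace (totI E F) : TotalSpace F V → Type _) p :=
  (0, connForm cov ξ p)

theorem smoothAt_zero_tot (p : TotalSpace F V) :
    SmoothAt (totI E F) (E × F) (fun q ↦ (0 : TangentSpace (totI E F) q)) p :=
  (contMDiff_zeroSection ℝ (TangentSpace (totI E F) : TotalSpace F V → Type _)).contMDiffAt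

theorem dualSmoothAt_zero_tot (p : TotalSpace F V) :
    DualSmoothAt (totI E F) (E × F) (fun q ↦ (0 : TangentSpace (totI E F) q →L[ℝ] ℝ)) p :=
  dualSmoothAt_of_forall fun _ _ ↦ contMDiffAt_const

variable [T2Space M]

theorem genSmoothAt_liftT (hcov : cov.ContMDiffCovariantDerivative ∞)
    {A : Π x : M, Gen (TangentSpace 𝓘(ℝ, E) : M → Type _) x}
    {p : TotalSpace F V} (hA : GenSmoothAt A p.proj) : GenSmoothAt (liftT cov A) p :=
  ⟨smoothAt_horField hcov hA.1, dualSmoothAt_projForm hcov hA.2⟩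

theorem genSmoothAt_liftV {s : Π x, V x} {p : TotalSpace F V} (hs : SmoothAt 𝓘(ℝ, E) F s p.proj) :
    GenSmoothAt (liftV (E := E) s) p :=
  ⟨smoothAt_vertField hs, dualSmoothAt_zero_tot p⟩

theorem genSmoothAt_liftVd (hcov : cov.ContMDiffCovariantDerivative ∞)
    {ξ : Π x, V x →L[ℝ] ℝ} {p : TotalSpace F V}
    (hξ : DualSmoothAt 𝓘(ℝ, E) F ξ p.proj) : GenSmoothAt (liftVd cov ξ) p :=
  ⟨smoothAt_zero_tot p, dualSmoothAt_connForm hcov hξ⟩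

theorem dproj_mlieBracket_vertField_horField (hcov : cov.ContMDiffCovariantDerivative ∞)
    {s : Π x, V x}
    {Y : Π x : M, TangentSpace 𝓘(ℝ, E) x} {p : TotalSpace F V}
    (hs : SmoothAt 𝓘(ℝ, E) F s p.proj) (hY : SmoothAt 𝓘(ℝ, E) E Y p.proj) :
    dproj E p (VectorField.mlieBracket (totI E F) (vertField s) (horField cov Y) p) = 0 := by
  rw [VectorField.mlieBracket_swap_apply, map_neg,
    dproj_mlieBracket_horField_vertField hcov hY hs, neg_zero]

theorem mvfderiv_pairing_liftT
    {A C : Π x : M, Gen (TangentSpace 𝓘(ℝ, E) : M → Type _) x}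
    {p : TotalSpace F V} (hA : GenSmoothAt A p.proj) (hC : GenSmoothAt C p.proj)
    (w : TangentSpace (totI E F) p) :
    mvfderiv (totI E F)
      (fun q ↦ (liftT cov A q).2 (liftT cov C q).1 - (liftT cov C q).2 (liftT cov A q).1) p w =
      mvfderiv 𝓘(ℝ, E) (fun x ↦ (A x).2 (C x).1 - (C x).2 (A x).1) p.proj (dproj E p w) := by
  have hd : ContMDiffAt 𝓘(ℝ, E) 𝓘(ℝ, ℝ) ∞ (fun x ↦ (A x).2 (C x).1 - (C x).2 (A x).1) p.proj :=
    (hA.2.apply hC.1).sub (hC.2.apply hA.1)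
  rw [← mvfderiv_comp_proj (hd.mdifferentiableAt (by simp))]
  simp only [liftT, projForm, horField, ContinuousLinearMap.coe_comp, Function.comp_apply,
    dproj_horLift]

theorem courant_liftT_vert (hcov : cov.ContMDiffCovariantDerivative ∞)
    {A C : Π x : M, Gen (TangentSpace 𝓘(ℝ, E) : M → Type _) x}
    {p : TotalSpace F V} (hA : GenSmoothAt A p.proj) (hC : GenSmoothAt C p.proj)
    (u : V p.proj) : (courant (totI E F) (liftT cov A) (liftT cov C) p).2 (vert p u) = 0 := by
  obtain ⟨s, hs, rfl⟩ := exists_smoothNear_eq (E := E) (F := F) u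
  refine (courant_snd_apply (genSmoothAt_liftT hcov hA) (genSmoothAt_liftT hcov hC)
    (smoothAt_vertField hs.smoothAt)).trans ?_
  have h1 := dproj_mlieBracket_horField_vertField hcov hA.1 hs.smoothAt
  have h2 := dproj_mlieBracket_horField_vertField hcov hC.1 hs.smoothAt
  rw [mvfderiv_pairing_liftT hA hC]
  simp only [liftT, projForm, ContinuousLinearMap.coe_comp, Function.comp_apply, h1, h2]
  simp only [vertField, dproj_vert, map_zero, mvfderiv_zero_apply, sub_zero, mul_zero, add_zero]

theorem courant_liftT_horLift (hcov : cov.ContMDiffCovariantDerivative ∞)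
    {A C : Π x : M, Gen (TangentSpace 𝓘(ℝ, E) : M → Type _) x}
    {p : TotalSpace F V} (hA : GenSmoothAt A p.proj) (hC : GenSmoothAt C p.proj)
    (v : TangentSpace 𝓘(ℝ, E) p.proj) :
    (courant (totI E F) (liftT cov A) (liftT cov C) p).2 (horLift cov p v) =
      (courant 𝓘(ℝ, E) A C p.proj).2 v := by
  obtain ⟨Z, hZ, rfl⟩ := exists_smoothNear_vectorField_eq (E := E) v
  refine (courant_snd_apply (genSmoothAt_liftT hcov hA) (genSmoothAt_liftT hcov hC)
    (smoothAt_horField hcov hZ.smoothAt)).trans ?_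
  have h1 := dproj_mlieBracket_horField hcov hA.1 hZ.smoothAt
  have h2 := dproj_mlieBracket_horField hcov hC.1 hZ.smoothAt
  have f1 := mvfderiv_comp_proj ((hC.2.apply hZ.smoothAt).mdifferentiableAt (by simp))
    (horLift cov p (A p.proj).1)
  have f2 := mvfderiv_comp_proj ((hA.2.apply hZ.smoothAt).mdifferentiableAt (by simp))
    (horLift cov p (C p.proj).1)
  rw [courant_snd_apply hA hC hZ.smoothAt, mvfderiv_pairing_liftT hA hC]
  simp only [liftT, projForm, ContinuousLinearMap.coe_comp, Function.comp_apply, h1, h2]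
  simp only [dproj_horLift] at f1 f2
  simp only [horField, dproj_horLift, f1, f2]

theorem splitF_courant_liftT (hcov : cov.ContMDiffCovariantDerivative ∞)
    {A C : Π x : M, Gen (TangentSpace 𝓘(ℝ, E) : M → Type _) x}
    {p : TotalSpace F V} (hp : p.2 = 0) (hA : ∀ᶠ x in 𝓝 p.proj, GenSmoothAt A x)
    (hC : ∀ᶠ x in 𝓝 p.proj, GenSmoothAt C x) :
    splitF cov p (courant (totI E F) (liftT cov A) (liftT cov C) p) =
      inclT p.proj (courant 𝓘(ℝ, E) A C p.proj) := by
  have hA1 : SmoothNear 𝓘(ℝ, E) E (fun x ↦ (A x).1) p.proj := hA.mono fun _ h ↦ h.1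
  have hC1 : SmoothNear 𝓘(ℝ, E) E (fun x ↦ (C x).1) p.proj := hC.mono fun _ h ↦ h.1
  have h1 : connProj cov p (courant (totI E F) (liftT cov A) (liftT cov C) p).1 = 0 := by
    rw [courant_fst, liftT_fst, liftT_fst, connProj_mlieBracket_horField hcov hp hA1 hC1]
  have h2 : dproj E p (courant (totI E F) (liftT cov A) (liftT cov C) p).1 =
      (courant 𝓘(ℝ, E) A C p.proj).1 := by
    rw [courant_fst, courant_fst, liftT_fst, liftT_fst,
      dproj_mlieBracket_horField hcov hA1.smoothAt hC1.smoothAt]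
  exact splitF_eq_inclT h1 h2 (courant_liftT_vert hcov hA.self_of_nhds hC.self_of_nhds)
    (courant_liftT_horLift hcov hA.self_of_nhds hC.self_of_nhds)

theorem courant_liftV_liftV (hcov : cov.ContMDiffCovariantDerivative ∞)
    {s t : Π x, V x} {p : TotalSpace F V}
    (hs : SmoothAt 𝓘(ℝ, E) F s p.proj) (ht : SmoothAt 𝓘(ℝ, E) F t p.proj) :
    courant (totI E F) (liftV s) (liftV t) p = 0 := by
  refine Prod.ext (mlieBracket_vertField hs ht cov) ?_
  have key {Z} (hZ : SmoothAt (totI E F) (E × F) Z p) :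
      (courant (totI E F) (liftV s) (liftV t) p).2 (Z p) = 0 := by
    rw [courant_snd_apply (genSmoothAt_liftV hs) (genSmoothAt_liftV ht) hZ]
    simp [liftV, mvfderiv_zero_apply]
  refine eq_zero_of_vert_of_horLift (cov := cov) (fun u ↦ ?_) (fun v ↦ ?_)
  · obtain ⟨r, hr, rfl⟩ := exists_smoothNear_eq (E := E) (F := F) u
    exact key (smoothAt_vertField hr.smoothAt)
  · obtain ⟨Z, hZ, rfl⟩ := exists_smoothNear_vectorField_eq (E := E) v
    exact key (smoothAt_horField hcov hZ.smoothAt)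

theorem courant_liftVd_liftVd (hcov : cov.ContMDiffCovariantDerivative ∞)
    {ξ ζ : Π x, V x →L[ℝ] ℝ} {p : TotalSpace F V}
    (hξ : DualSmoothAt 𝓘(ℝ, E) F ξ p.proj) (hζ : DualSmoothAt 𝓘(ℝ, E) F ζ p.proj) :
    courant (totI E F) (liftVd cov ξ) (liftVd cov ζ) p = 0 := by
  have h0 : VectorField.mlieBracket (totI E F)
      (fun q : TotalSpace F V ↦ (0 : TangentSpace (totI E F) q)) = 0 :=
    funext fun W ↦ VectorField.mlieBracket_zero_left
  refine Prod.ext (congrFun (congrFun h0 _) p) ?_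
  have key {Z} (hZ : SmoothAt (totI E F) (E × F) Z p) :
      (courant (totI E F) (liftVd cov ξ) (liftVd cov ζ) p).2 (Z p) = 0 := by
    rw [courant_snd_apply (genSmoothAt_liftVd hcov hξ) (genSmoothAt_liftVd hcov hζ) hZ]
    simp [liftVd, h0, mvfderiv_zero_apply]
  refine eq_zero_of_vert_of_horLift (cov := cov) (fun u ↦ ?_) (fun v ↦ ?_)
  · obtain ⟨r, hr, rfl⟩ := exists_smoothNear_eq (E := E) (F := F) u
    exact key (smoothAt_vertField hr.smoothAt)
  · obtain ⟨Z, hZ, rfl⟩ := exists_smoothNear_vectorField_eq (E := E) v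
    exact key (smoothAt_horField hcov hZ.smoothAt)

theorem splitF_courant_liftT_liftV (hcov : cov.ContMDiffCovariantDerivative ∞)
    {A : Π x : M, Gen (TangentSpace 𝓘(ℝ, E) : M → Type _) x}
    {t : Π x, V x} {p : TotalSpace F V} (hA : GenSmoothAt A p.proj)
    (ht : SmoothAt 𝓘(ℝ, E) F t p.proj) :
    ∃ u, splitF cov p (courant (totI E F) (liftT cov A) (liftV t) p) = inclV p.proj (u, 0) := by
  have hAt := genSmoothAt_liftT hcov hA
  have htt := genSmoothAt_liftV (E := E) ht
  have e (w) : mvfderiv (totI E F)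
      (fun q ↦ (liftT cov A q).2 (liftV (E := E) t q).1 -
        (liftV (E := E) t q).2 (liftT cov A q).1) p w = 0 := by
    simp [liftT, projForm, liftV, vertField, dproj_vert, mvfderiv_zero_apply]
  have h0 : (courant (totI E F) (liftT cov A) (liftV t) p).2 = 0 := by
    refine eq_zero_of_vert_of_horLift (cov := cov) (fun u ↦ ?_) (fun v ↦ ?_)
    · obtain ⟨s, hs, rfl⟩ := exists_smoothNear_eq (E := E) (F := F) u
      refine (courant_snd_apply hAt htt (smoothAt_vertField hs.smoothAt)).trans ?_
      rw [e]
      have h1 := mlieBracket_vertField ht hs.smoothAt cov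
      simp only [liftV, h1]
      simp [liftT, projForm, vertField, dproj_vert, mvfderiv_zero_apply]
    · obtain ⟨Z, hZ, rfl⟩ := exists_smoothNear_vectorField_eq (E := E) v
      refine (courant_snd_apply hAt htt (smoothAt_horField hcov hZ.smoothAt)).trans ?_
      rw [e]
      have h1 := dproj_mlieBracket_vertField_horField hcov ht hZ.smoothAt
      have f1 := mvfderiv_comp_proj ((hA.2.apply hZ.smoothAt).mdifferentiableAt (by simp))
        (vertField t p)
      simp only [liftT, liftV, projForm, ContinuousLinearMap.coe_comp, Function.comp_apply, h1,
        horField, dproj_horLift, f1]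
      simp [vertField, dproj_vert, mvfderiv_zero_apply]
  refine ⟨connProj cov p (courant (totI E F) (liftT cov A) (liftV t) p).1, ?_⟩
  rw [splitF_eq_inclV (dproj_mlieBracket_horField_vertField hcov hA.1 ht) fun v ↦ by rw [h0]; rfl,
    h0, ContinuousLinearMap.zero_comp]

theorem splitF_courant_liftT_liftVd (hcov : cov.ContMDiffCovariantDerivative ∞)
    {A : Π x : M, Gen (TangentSpace 𝓘(ℝ, E) : M → Type _) x}
    {ζ : Π x, V x →L[ℝ] ℝ} {p : TotalSpace F V} (hp : p.2 = 0)
    (hA : ∀ᶠ x in 𝓝 p.proj, GenSmoothAt A x)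
    (hζ : DualSmoothAt 𝓘(ℝ, E) F ζ p.proj) :
    ∃ θ, splitF cov p (courant (totI E F) (liftT cov A) (liftVd cov ζ) p) =
      inclV p.proj (0, θ) := by
  have hA1 : SmoothNear 𝓘(ℝ, E) E (fun x ↦ (A x).1) p.proj := hA.mono fun _ h ↦ h.1
  have hA0 := hA.self_of_nhds
  have hAt := genSmoothAt_liftT hcov hA0
  have hζt := genSmoothAt_liftVd hcov hζ
  have h0 : VectorField.mlieBracket (totI E F)
      (fun q : TotalSpace F V ↦ (0 : TangentSpace (totI E F) q)) = 0 :=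
    funext fun W ↦ VectorField.mlieBracket_zero_left
  have h1 : (courant (totI E F) (liftT cov A) (liftVd cov ζ) p).1 = 0 :=
    congrFun (VectorField.mlieBracket_zero_right (I := totI E F)) p
  refine ⟨_, (splitF_eq_inclV (by rw [h1, map_zero]) fun v ↦ ?_).trans (by rw [h1, map_zero])⟩
  obtain ⟨Z, hZ, rfl⟩ := exists_smoothNear_vectorField_eq (E := E) v
  refine (courant_snd_apply hAt hζt (smoothAt_horField hcov hZ.smoothAt)).trans ?_
  have h2 := connProj_mlieBracket_horField hcov hp hA1 hZ
  simp only [liftT, liftVd, connForm, ContinuousLinearMap.coe_comp, Function.comp_apply, h2]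
  simp [h0, horField, connProj_horLift, mvfderiv_zero_apply]

end Lifts

section Splitting

variable {E : Type*} [NormedAddCommGroup E] [NormedSpace ℝ E] [FiniteDimensional ℝ E]
  {M : Type*} [TopologicalSpace M] [ChartedSpace E M] [IsManifold 𝓘(ℝ, E) ∞ M]
  {F : Type*} [NormedAddCommGroup F] [NormedSpace ℝ F] [FiniteDimensional ℝ F]
  {V : M → Type*} [TopologicalSpace (TotalSpace F V)]
  [∀ x, AddCommGroup (V x)] [∀ x, Module ℝ (V x)] [∀ x, TopologicalSpace (V x)]
  [∀ x, IsTopologicalAddGroup (V x)] [∀ x, ContinuousSMul ℝ (V x)]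
  [FiberBundle F V] [VectorBundle ℝ F V] [ContMDiffVectorBundle ∞ F V 𝓘(ℝ, E)]
  {cov : CovariantDerivative 𝓘(ℝ, E) F V}

theorem splitF_splitFInv (p : TotalSpace F V) (b : Gen (VT E V) p.proj) :
    splitF cov p (splitFInv cov p b) = b := by
  refine Prod.ext (Prod.ext ?_ ?_) ?_
  · simp [splitF, splitFInv, connProj_vert, connProj_horLift]
  · simp [splitF, splitFInv, dproj_vert, dproj_horLift]
  · ext v
    · simp [splitF, splitFInv, connProj_vert, dproj_vert]
    · simp [splitF, splitFInv, connProj_horLift, dproj_horLift]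

theorem splitF_add (p : TotalSpace F V)
    (a b : Gen (TangentSpace (totI E F) : TotalSpace F V → Type _) p) :
    splitF cov p (a + b) = splitF cov p a + splitF cov p b := by
  refine Prod.ext (Prod.ext ?_ ?_) ?_
  · exact map_add _ _ _
  · exact map_add _ _ _
  · exact ContinuousLinearMap.add_comp _ _ _

theorem splitFInv_neg (p : TotalSpace F V) (b : Gen (VT E V) p.proj) :
    splitFInv cov p (-b) = -splitFInv cov p b := by
  refine Prod.ext ?_ ?_
  · simp [splitFInv, add_comm]
  · exact ContinuousLinearMap.neg_comp _ _

theorem splitFInv_inclT (p : TotalSpace F V)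
    (A : Π x : M, Gen (TangentSpace 𝓘(ℝ, E) : M → Type _) x) :
    splitFInv cov p (inclT p.proj (A p.proj)) = liftT cov A p := by
  refine Prod.ext ?_ ?_
  · simp [splitFInv, inclT, liftT, horField]
  · ext w
    simp [splitFInv, inclT, liftT, projForm]

theorem splitFInv_inclV_left (p : TotalSpace F V) (s : Π x, V x) :
    splitFInv cov p (inclV p.proj (s p.proj, 0)) = liftV (E := E) s p := by
  refine Prod.ext ?_ ?_
  · simp [splitFInv, inclV, liftV, vertField]
  · ext w
    simp [splitFInv, inclV, liftV]

theorem splitFInv_inclV_right (p : TotalSpace F V) (ξ : Π x, V x →L[ℝ] ℝ) :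
    splitFInv cov p (inclV p.proj (0, ξ p.proj)) = liftVd cov ξ p := by
  refine Prod.ext ?_ ?_
  · simp [splitFInv, inclV, liftVd]
  · ext w
    simp [splitFInv, inclV, liftVd, connForm]

/-- A lift to the total space determines the structure on the base. -/
theorem IsLiftOf.unique
    {𝒥 : GACS (totI E F) (E × F) (TangentSpace (totI E F) : TotalSpace F V → Type _)}
    {J J' : GACS 𝓘(ℝ, E) (F × E) (VT E V)} (h : IsLiftOf cov 𝒥 J) (h' : IsLiftOf cov 𝒥 J') :
    J' = J := by
  have key {J : GACS 𝓘(ℝ, E) (F × E) (VT E V)} (h : IsLiftOf cov 𝒥 J) (p : TotalSpace F V)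
      (b : Gen (VT E V) p.proj) : J.J p.proj b = splitF cov p (𝒥.J p (splitFInv cov p b)) := by
    rw [h, splitF_splitFInv, splitF_splitFInv]
  refine GACS.ext (funext fun x ↦ ContinuousLinearMap.ext fun b ↦ ?_)
  exact (key h' (TotalSpace.mk' F x 0) b).trans (key h (TotalSpace.mk' F x 0) b).symm

/-! ### Adapted structures -/

/-- The projection of `(V ⊕ T_M) ⊕ (V ⊕ T_M)^∨` onto `V ⊕ V^∨`. -/
def projV (x : M) : Gen (VT E V) x →ₗ[ℝ] Gen V x where
  toFun b := (b.1.1, b.2.comp (ContinuousLinearMap.inl ℝ (V x) (TangentSpace 𝓘(ℝ, E) x)))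
  map_add' a b := by ext <;> simp
  map_smul' c a := by ext <;> simp

theorem projT_inclT (x : M) (c : Gen (TangentSpace 𝓘(ℝ, E) : M → Type _) x) :
    projT (V := V) x (inclT x c) = c := by
  refine Prod.ext rfl ?_
  ext v
  simp [projT, inclT]

theorem projV_inclV (x : M) (a : Gen V x) : projV (E := E) x (inclV x a) = a := by
  refine Prod.ext rfl ?_
  ext v
  simp [projV, inclV]

theorem pairing_inclT (x : M) (b c : Gen (TangentSpace 𝓘(ℝ, E) : M → Type _) x) :
    pairing (inclT (V := V) x b) (inclT x c) = pairing b c := by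
  simp [pairing, inclT]

theorem pairing_inclV (x : M) (a b : Gen V x) :
    pairing (inclV (E := E) x a) (inclV x b) = pairing a b := by
  simp [pairing, inclV]

/-- The inverse of `baseMap J x`, for an adapted structure `J`. -/
def baseInv (J : GACS 𝓘(ℝ, E) (F × E) (VT E V)) (x : M) :
    Gen (TangentSpace 𝓘(ℝ, E) : M → Type _) x →ₗ[ℝ] Gen V x :=
  -(projV x).comp ((J.J x : Gen (VT E V) x →ₗ[ℝ] Gen (VT E V) x).comp (inclT x))

variable {J : GACS 𝓘(ℝ, E) (F × E) (VT E V)}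

theorem IsAdapted.J_inclV (hJ : IsAdapted J) (x : M) (a : Gen V x) :
    J.J x (inclV x a) = inclT x (baseMap J x a) := by
  obtain ⟨c, hc⟩ : J.J x (inclV x a) ∈ LinearMap.range (inclT x) := by
    rw [← hJ x]
    exact ⟨_, ⟨a, rfl⟩, rfl⟩
  have : baseMap J x a = c := by
    change projT x (J.J x (inclV x a)) = c
    rw [← hc, projT_inclT]
  rw [this, hc]

theorem IsAdapted.J_inclT_baseMap (hJ : IsAdapted J) (x : M) (a : Gen V x) :
    J.J x (inclT x (baseMap J x a)) = -inclV x a := by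
  rw [← hJ.J_inclV, J.sq]

theorem IsAdapted.baseInv_baseMap (hJ : IsAdapted J) (x : M) (a : Gen V x) :
    baseInv J x (baseMap J x a) = a := by
  change -projV x (J.J x (inclT x (baseMap J x a))) = a
  rw [hJ.J_inclT_baseMap, map_neg, neg_neg, projV_inclV]

theorem IsAdapted.baseMap_surjective (hJ : IsAdapted J) (x : M) :
    Function.Surjective (baseMap J x) := by
  intro c
  have hc : inclT x c ∈ LinearMap.range (inclT (E := E) (V := V) x) := ⟨c, rfl⟩
  rw [← hJ x] at hc
  obtain ⟨_, ⟨a, rfl⟩, ha⟩ := hc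
  refine ⟨a, ?_⟩
  rw [← projT_inclT (V := V) x (baseMap J x a), ← hJ.J_inclV, ← projT_inclT (V := V) x c]
  exact congrArg _ ha

theorem IsAdapted.baseMap_baseInv (hJ : IsAdapted J) (x : M)
    (c : Gen (TangentSpace 𝓘(ℝ, E) : M → Type _) x) : baseMap J x (baseInv J x c) = c := by
  obtain ⟨a, rfl⟩ := hJ.baseMap_surjective x c
  rw [hJ.baseInv_baseMap]

theorem IsAdapted.baseMap_injective (hJ : IsAdapted J) (x : M) :
    Function.Injective (baseMap J x) :=
  Function.LeftInverse.injective (hJ.baseInv_baseMap x)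

theorem IsAdapted.pairing_baseMap (hJ : IsAdapted J) (x : M) (a b : Gen V x) :
    pairing (baseMap J x a) (baseMap J x b) = pairing a b := by
  rw [← pairing_inclT (V := V), ← hJ.J_inclV, ← hJ.J_inclV, J.orthogonal, pairing_inclV]

/-! ### Smoothness of sections of `V ⊕ T_M` -/

theorem smoothAt_VT_iff {s : Π x : M, VT E V x} {x : M} :
    SmoothAt 𝓘(ℝ, E) (F × E) s x ↔
      SmoothAt 𝓘(ℝ, E) F (fun y ↦ (s y).1) x ∧ SmoothAt 𝓘(ℝ, E) E (fun y ↦ (s y).2) x := by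
  simp only [SmoothAt, contMDiffAt_section]
  exact contMDiffAt_prod_module_iff _

theorem dualSmoothAt_VT_iff {φ : Π x : M, VT E V x →L[ℝ] ℝ} {x : M} :
    DualSmoothAt 𝓘(ℝ, E) (F × E) φ x ↔
      DualSmoothAt 𝓘(ℝ, E) F
        (fun y ↦ (φ y).comp (ContinuousLinearMap.inl ℝ (V y) (TangentSpace 𝓘(ℝ, E) y))) x ∧
      DualSmoothAt 𝓘(ℝ, E) E
        (fun y ↦ (φ y).comp (ContinuousLinearMap.inr ℝ (V y) (TangentSpace 𝓘(ℝ, E) y))) x := by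
  constructor
  · intro h
    constructor
    · refine dualSmoothAt_of_forall fun s hs ↦ ?_
      exact h.apply (s := fun y ↦ (s y, 0)) (smoothAt_VT_iff.2 ⟨hs.smoothAt, smoothAt_zero x⟩)
    · refine dualSmoothAt_of_forall fun Y hY ↦ ?_
      refine h.apply (s := fun y ↦ (0, Y y)) (smoothAt_VT_iff.2 ⟨?_, hY.smoothAt⟩)
      exact (contMDiff_zeroSection ℝ V).contMDiffAt
  · rintro ⟨h1, h2⟩
    refine dualSmoothAt_of_forall fun s hs ↦ ?_
    have hs' := smoothAt_VT_iff.1 hs.smoothAt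
    refine ((h1.apply hs'.1).add (h2.apply hs'.2)).congr_of_eventuallyEq (.of_forall fun y ↦ ?_)
    simp [← map_add]

theorem genSmoothOn_inclV {U : Set M} (hU : IsOpen U) {a : Π x, Gen V x}
    (ha : GenSmoothOn 𝓘(ℝ, E) F U a) :
    GenSmoothOn 𝓘(ℝ, E) (F × E) U (fun x ↦ inclV (E := E) x (a x)) := by
  refine ⟨(smoothOn_iff hU).2 fun x hx ↦ smoothAt_VT_iff.2
    ⟨(smoothOn_iff hU).1 ha.1 x hx, smoothAt_zero x⟩, (dualSmoothOn_iff hU).2 fun x hx ↦ ?_⟩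
  refine dualSmoothAt_of_forall fun s hs ↦ ?_
  exact ((dualSmoothOn_iff hU).1 ha.2 x hx).apply (smoothAt_VT_iff.1 hs.smoothAt).1

theorem genSmoothOn_inclT {U : Set M} (hU : IsOpen U)
    {a : Π x, Gen (TangentSpace 𝓘(ℝ, E) : M → Type _) x} (ha : GenSmoothOn 𝓘(ℝ, E) E U a) :
    GenSmoothOn 𝓘(ℝ, E) (F × E) U (fun x ↦ inclT (V := V) x (a x)) := by
  refine ⟨(smoothOn_iff hU).2 fun x hx ↦ smoothAt_VT_iff.2
    ⟨(contMDiff_zeroSection ℝ V).contMDiffAt, (smoothOn_iff hU).1 ha.1 x hx⟩,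
    (dualSmoothOn_iff hU).2 fun x hx ↦ ?_⟩
  refine dualSmoothAt_of_forall fun s hs ↦ ?_
  exact ((dualSmoothOn_iff hU).1 ha.2 x hx).apply (smoothAt_VT_iff.1 hs.smoothAt).2

theorem genSmoothOn_projT {U : Set M} (hU : IsOpen U) {b : Π x, Gen (VT E V) x}
    (hb : GenSmoothOn 𝓘(ℝ, E) (F × E) U b) :
    GenSmoothOn 𝓘(ℝ, E) E U (fun x ↦ projT x (b x)) :=
  ⟨(smoothOn_iff hU).2 fun x hx ↦ (smoothAt_VT_iff.1 ((smoothOn_iff hU).1 hb.1 x hx)).2,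
    (dualSmoothOn_iff hU).2 fun x hx ↦
      (dualSmoothAt_VT_iff.1 ((dualSmoothOn_iff hU).1 hb.2 x hx)).2⟩

theorem genSmoothOn_neg_projV {U : Set M} (hU : IsOpen U) {b : Π x, Gen (VT E V) x}
    (hb : GenSmoothOn 𝓘(ℝ, E) (F × E) U b) :
    GenSmoothOn 𝓘(ℝ, E) F U (fun x ↦ -projV x (b x)) := by
  refine ⟨(smoothOn_iff hU).2 fun x hx ↦ ?_, (dualSmoothOn_iff hU).2 fun x hx ↦ ?_⟩
  · exact ContMDiffAt.neg_section (smoothAt_VT_iff.1 ((smoothOn_iff hU).1 hb.1 x hx)).1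
  · refine dualSmoothAt_of_forall fun s hs ↦ ?_
    exact ((dualSmoothAt_VT_iff.1 ((dualSmoothOn_iff hU).1 hb.2 x hx)).1.apply hs.smoothAt).neg

theorem genSmoothOn_baseMap (J : GACS 𝓘(ℝ, E) (F × E) (VT E V)) {U : Set M} (hU : IsOpen U)
    {a : Π x, Gen V x} (ha : GenSmoothOn 𝓘(ℝ, E) F U a) :
    GenSmoothOn 𝓘(ℝ, E) E U (fun x ↦ baseMap J x (a x)) :=
  genSmoothOn_projT hU (J.smooth U _ hU (genSmoothOn_inclV hU ha))

theorem genSmoothOn_baseInv (J : GACS 𝓘(ℝ, E) (F × E) (VT E V)) {U : Set M} (hU : IsOpen U)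
    {a : Π x, Gen (TangentSpace 𝓘(ℝ, E) : M → Type _) x} (ha : GenSmoothOn 𝓘(ℝ, E) E U a) :
    GenSmoothOn 𝓘(ℝ, E) F U (fun x ↦ baseInv J x (a x)) :=
  genSmoothOn_neg_projV hU (J.smooth U _ hU (genSmoothOn_inclT hU ha))

end Splitting

section Subbundle

variable {E : Type*} [NormedAddCommGroup E] [NormedSpace ℝ E] [FiniteDimensional ℝ E]
  {H : Type*} [TopologicalSpace H] {I : ModelWithCorners ℝ E H}
  {B : Type*} [TopologicalSpace B] [ChartedSpace H B] [IsManifold I 2 B]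

theorem isSubbundle_of_frame {Δ : Π x : B, Submodule ℝ (Gen (TangentSpace I : B → Type _) x)}
    (G : Type*) [NormedAddCommGroup G] [NormedSpace ℝ G] [FiniteDimensional ℝ G]
    (h : ∀ x₀, ∃ (U : Set B) (Θ : Π x : B, G →ₗ[ℝ] Gen (TangentSpace I : B → Type _) x),
      IsOpen U ∧ x₀ ∈ U ∧ (∀ c, GenSmoothOn I E U fun x ↦ Θ x c) ∧
      ∀ x ∈ U, Function.Injective (Θ x) ∧ LinearMap.range (Θ x) = Δ x) : IsSubbundle I Δ := by
  intro x₀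
  obtain ⟨U, Θ, hU, hx₀, hs, hΘ⟩ := h x₀
  refine ⟨U, _, fun i x ↦ Θ x (Module.finBasis ℝ G i), hU, hx₀, fun i ↦ hs _, fun x hx ↦ ⟨?_, ?_⟩⟩
  · exact (Module.finBasis ℝ G).linearIndependent.map' _ (LinearMap.ker_eq_bot.2 (hΘ x hx).1)
  · rw [← (hΘ x hx).2, LinearMap.range_eq_map, ← (Module.finBasis ℝ G).span_eq,
      Submodule.map_span, ← range_comp]
    rfl

end Subbundle

section Dirac

variable {E : Type*} [NormedAddCommGroup E] [NormedSpace ℝ E] [FiniteDimensional ℝ E]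
  {M : Type*} [TopologicalSpace M] [ChartedSpace E M] [IsManifold 𝓘(ℝ, E) ∞ M]
  {F : Type*} [NormedAddCommGroup F] [NormedSpace ℝ F] [FiniteDimensional ℝ F]
  {V : M → Type*} [TopologicalSpace (TotalSpace F V)]
  [∀ x, AddCommGroup (V x)] [∀ x, Module ℝ (V x)] [∀ x, TopologicalSpace (V x)]
  [∀ x, IsTopologicalAddGroup (V x)] [∀ x, ContinuousSMul ℝ (V x)]
  [FiberBundle F V] [VectorBundle ℝ F V] [ContMDiffVectorBundle ∞ F V 𝓘(ℝ, E)]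
  {cov : CovariantDerivative 𝓘(ℝ, E) F V} {J : GACS 𝓘(ℝ, E) (F × E) (VT E V)}

theorem IsAdapted.mem_diracV (hJ : IsAdapted J) {x : M}
    {c : Gen (TangentSpace 𝓘(ℝ, E) : M → Type _) x} :
    c ∈ diracV J x ↔ (baseInv J x c).2 = 0 := by
  constructor
  · rintro ⟨u, rfl⟩
    exact congrArg Prod.snd (hJ.baseInv_baseMap x (u, 0))
  · intro h
    refine ⟨(baseInv J x c).1, ?_⟩
    rw [← hJ.baseMap_baseInv x c, hJ.baseInv_baseMap]
    exact congrArg (baseMap J x) (Prod.ext rfl h.symm)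

theorem IsAdapted.mem_diracVDual (hJ : IsAdapted J) {x : M}
    {c : Gen (TangentSpace 𝓘(ℝ, E) : M → Type _) x} :
    c ∈ diracVDual J x ↔ (baseInv J x c).1 = 0 := by
  constructor
  · rintro ⟨u, rfl⟩
    exact congrArg Prod.fst (hJ.baseInv_baseMap x (0, u))
  · intro h
    refine ⟨(baseInv J x c).2, ?_⟩
    rw [← hJ.baseMap_baseInv x c, hJ.baseInv_baseMap]
    exact congrArg (baseMap J x) (Prod.ext h.symm rfl)

theorem IsAdapted.isCompl (hJ : IsAdapted J) (x : M) : IsCompl (diracV J x) (diracVDual J x) := by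
  constructor
  · rw [Submodule.disjoint_def]
    intro c h1 h2
    rw [← hJ.baseMap_baseInv x c,
      show baseInv J x c = 0 from Prod.ext (hJ.mem_diracVDual.1 h2) (hJ.mem_diracV.1 h1), map_zero]
  · rw [codisjoint_iff, Submodule.eq_top_iff']
    intro c
    obtain ⟨⟨u, ξ⟩, rfl⟩ := hJ.baseMap_surjective x c
    refine Submodule.mem_sup.2 ⟨_, ⟨u, rfl⟩, _, ⟨ξ, rfl⟩, ?_⟩
    rw [LinearMap.comp_apply, LinearMap.comp_apply, ← map_add]
    simp

theorem IsAdapted.maximal_isotropic_diracV (hJ : IsAdapted J) (x : M) :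
    Maximal IsIsotropic (diracV J x) := by
  refine ⟨?_, fun S hS hle c hc ↦ hJ.mem_diracV.2 ?_⟩
  · rintro _ ⟨u, rfl⟩ _ ⟨w, rfl⟩
    exact (hJ.pairing_baseMap x (u, 0) (w, 0)).trans (by simp [pairing])
  · ext u
    have h := hS c hc _ (hle ⟨u, rfl⟩)
    rw [← hJ.baseMap_baseInv x c] at h
    have h' := (hJ.pairing_baseMap x (baseInv J x c) (u, 0)).symm.trans h
    simpa [pairing] using h'

theorem IsAdapted.maximal_isotropic_diracVDual (hJ : IsAdapted J) (x : M) :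
    Maximal IsIsotropic (diracVDual J x) := by
  refine ⟨?_, fun S hS hle c hc ↦ hJ.mem_diracVDual.2 ?_⟩
  · rintro _ ⟨u, rfl⟩ _ ⟨w, rfl⟩
    exact (hJ.pairing_baseMap x (0, u) (0, w)).trans (by simp [pairing])
  · refine eq_zero_of_forall_dual (E := E) (F := F) fun ξ _ ↦ ?_
    have h := hS c hc _ (hle ⟨ξ x, rfl⟩)
    rw [← hJ.baseMap_baseInv x c] at h
    have h' := (hJ.pairing_baseMap x (baseInv J x c) (0, ξ x)).symm.trans h
    simpa [pairing] using h'

theorem dualSmoothAt_zero (x : M) :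
    DualSmoothAt 𝓘(ℝ, E) F (fun y ↦ (0 : V y →L[ℝ] ℝ)) x :=
  dualSmoothAt_of_forall fun _ _ ↦ contMDiffAt_const

theorem genSmoothOn_left {U : Set M} (hU : IsOpen U) {s : Π x, V x}
    (hs : SmoothOn 𝓘(ℝ, E) F U s) :
    GenSmoothOn 𝓘(ℝ, E) F U (fun x ↦ ((s x, 0) : Gen V x)) :=
  ⟨hs, (dualSmoothOn_iff hU).2 fun x _ ↦ dualSmoothAt_zero x⟩

theorem genSmoothOn_right {U : Set M} {ξ : Π x, V x →L[ℝ] ℝ}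
    (hξ : DualSmoothOn 𝓘(ℝ, E) F U ξ) :
    GenSmoothOn 𝓘(ℝ, E) F U (fun x ↦ ((0, ξ x) : Gen V x)) :=
  ⟨(contMDiff_zeroSection ℝ V).contMDiffOn, hξ⟩

theorem IsAdapted.isSubbundle_diracV (hJ : IsAdapted J) : IsSubbundle 𝓘(ℝ, E) (diracV J) := by
  refine isSubbundle_of_frame F fun x₀ ↦ ?_
  set e := trivializationAt F V x₀
  refine ⟨e.baseSet, fun x ↦ ((baseMap J x).comp (LinearMap.inl ℝ (V x) (V x →L[ℝ] ℝ))).comp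
    (e.symmL ℝ x : F →ₗ[ℝ] V x), e.open_baseSet, mem_baseSet_trivializationAt F V x₀,
    fun c ↦ ?_, fun x hx ↦ ?_⟩
  · refine genSmoothOn_baseMap J e.open_baseSet (genSmoothOn_left e.open_baseSet ?_)
    refine (smoothOn_iff e.open_baseSet).2 fun x hx ↦ (smoothAt_symm e hx c).congr ?_
    filter_upwards [e.open_baseSet.mem_nhds hx] with y hy
    exact e.symmL_apply hy c
  · refine ⟨?_, ?_⟩
    · exact ((hJ.baseMap_injective x).comp LinearMap.inl_injective).comp
        (Function.LeftInverse.injective (e.continuousLinearMapAt_symmL (R := ℝ) hx))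
    · refine LinearMap.range_comp_of_range_eq_top _ (LinearMap.range_eq_top.2 ?_)
      exact Function.RightInverse.surjective (e.symmL_continuousLinearMapAt (R := ℝ) hx)

theorem IsAdapted.isSubbundle_diracVDual (hJ : IsAdapted J) :
    IsSubbundle 𝓘(ℝ, E) (diracVDual J) := by
  refine isSubbundle_of_frame (F →L[ℝ] ℝ) fun x₀ ↦ ?_
  set e := trivializationAt F V x₀
  let T (x : M) : (F →L[ℝ] ℝ) →ₗ[ℝ] (V x →L[ℝ] ℝ) :=
    { toFun := fun l ↦ coordForm e l x
      map_add' := fun l l' ↦ ContinuousLinearMap.add_comp _ _ _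
      map_smul' := fun c l ↦ ContinuousLinearMap.smul_comp _ _ _ }
  refine ⟨e.baseSet, fun x ↦ ((baseMap J x).comp (LinearMap.inr ℝ (V x) (V x →L[ℝ] ℝ))).comp
    (T x), e.open_baseSet, mem_baseSet_trivializationAt F V x₀, fun c ↦ ?_, fun x hx ↦ ?_⟩
  · refine genSmoothOn_baseMap J e.open_baseSet (genSmoothOn_right ?_)
    exact (dualSmoothOn_iff e.open_baseSet).2 fun x hx ↦ dualSmoothAt_coordForm e c hx
  · refine ⟨?_, ?_⟩
    · refine ((hJ.baseMap_injective x).comp LinearMap.inr_injective).comp fun l l' h ↦ ?_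
      ext c
      have := congrArg (fun ξ : V x →L[ℝ] ℝ ↦ ξ (e.symmL ℝ x c)) h
      simpa [T, coordForm, e.continuousLinearMapAt_symmL (R := ℝ) hx] using this
    · refine LinearMap.range_comp_of_range_eq_top _ (LinearMap.range_eq_top.2 fun ξ ↦ ?_)
      refine ⟨ξ.comp (e.symmL ℝ x), ?_⟩
      ext v
      exact congrArg ξ (e.symmL_continuousLinearMapAt (R := ℝ) hx v)

/-! ### Involutivity -/

theorem splitF_neg (p : TotalSpace F V)
    (a : Gen (TangentSpace (totI E F) : TotalSpace F V → Type _) p) :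
    splitF cov p (-a) = -splitF cov p a := by
  refine Prod.ext (Prod.ext ?_ ?_) ?_
  · exact map_neg _ _
  · exact map_neg _ _
  · exact ContinuousLinearMap.neg_comp _ _

variable {𝒥 : GACS (totI E F) (E × F) (TangentSpace (totI E F) : TotalSpace F V → Type _)}

theorem IsLiftOf.memEigen (h : IsLiftOf cov 𝒥 J) (hJ : IsAdapted J) (p : TotalSpace F V)
    (a : Gen V p.proj) :
    MemEigen (totI E F) (𝒥.J p) (splitFInv cov p (inclT p.proj (baseMap J p.proj a)))
      (splitFInv cov p (inclV p.proj a)) := by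
  constructor
  · rw [h, splitF_splitFInv, hJ.J_inclT_baseMap, splitFInv_neg]
  · rw [h, splitF_splitFInv, hJ.J_inclV]

/-- If the Courant brackets of the lifts of sections of a subbundle of `V ⊕ V^∨` are as in a
semi-direct product, then so are those of their images in `T_M ⊕ T_M^∨`. -/
theorem courant_eq_baseMap [T2Space M] (hcov : cov.ContMDiffCovariantDerivative ∞)
    (h : IsLiftOf cov 𝒥 J) (hJ : IsAdapted J) (hint : 𝒥.IsIntegrable) {U : Set M} (hU : IsOpen U)
    {A C : Π x : M, Gen (TangentSpace 𝓘(ℝ, E) : M → Type _) x}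
    (hA : GenSmoothOn 𝓘(ℝ, E) E U A) (hC : GenSmoothOn 𝓘(ℝ, E) E U C)
    {b d : Π p : TotalSpace F V, Gen (TangentSpace (totI E F) : TotalSpace F V → Type _) p}
    (hb : ∀ p : TotalSpace F V, p.proj ∈ U → GenSmoothAt b p)
    (hd : ∀ p : TotalSpace F V, p.proj ∈ U → GenSmoothAt d p)
    (hAb : ∀ p : TotalSpace F V, p.proj ∈ U →
      b p = splitFInv cov p (inclV p.proj (baseInv J p.proj (A p.proj))))
    (hCd : ∀ p : TotalSpace F V, p.proj ∈ U →
      d p = splitFInv cov p (inclV p.proj (baseInv J p.proj (C p.proj))))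
    {p : TotalSpace F V} (hp : p.2 = 0) (hpU : p.proj ∈ U) (h0 : courant (totI E F) b d p = 0)
    {w w' : Gen V p.proj}
    (hw : splitF cov p (courant (totI E F) (liftT cov A) d p) = inclV p.proj w)
    (hw' : splitF cov p (courant (totI E F) (liftT cov C) b p) = inclV p.proj w') :
    courant 𝓘(ℝ, E) A C p.proj = baseMap J p.proj (w - w') := by
  have hU' : IsOpen {q : TotalSpace F V | q.proj ∈ U} :=
    hU.preimage (FiberBundle.continuous_proj F V)
  have hA' (x) (hx : x ∈ U) : GenSmoothAt A x :=
    ⟨(smoothOn_iff hU).1 hA.1 x hx, (dualSmoothOn_iff hU).1 hA.2 x hx⟩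
  have hC' (x) (hx : x ∈ U) : GenSmoothAt C x :=
    ⟨(smoothOn_iff hU).1 hC.1 x hx, (dualSmoothOn_iff hU).1 hC.2 x hx⟩
  have smooth {a : Π p : TotalSpace F V, Gen (TangentSpace (totI E F) : TotalSpace F V → Type _) p}
      (ha : ∀ p : TotalSpace F V, p.proj ∈ U → GenSmoothAt a p) :
      GenSmoothOn (totI E F) (E × F) {q : TotalSpace F V | q.proj ∈ U} a :=
    ⟨(smoothOn_iff hU').2 fun q hq ↦ (ha q hq).1, (dualSmoothOn_iff hU').2 fun q hq ↦ (ha q hq).2⟩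
  have eigen {A : Π x : M, Gen (TangentSpace 𝓘(ℝ, E) : M → Type _) x}
      {b : Π p : TotalSpace F V, Gen (TangentSpace (totI E F) : TotalSpace F V → Type _) p}
      (hAb : ∀ p : TotalSpace F V, p.proj ∈ U →
        b p = splitFInv cov p (inclV p.proj (baseInv J p.proj (A p.proj)))) (q : TotalSpace F V)
      (hq : q.proj ∈ U) : MemEigen (totI E F) (𝒥.J q) (liftT cov A q) (b q) := by
    have := h.memEigen hJ q (baseInv J q.proj (A q.proj))
    rwa [hJ.baseMap_baseInv, splitFInv_inclT, ← hAb q hq] at this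
  obtain ⟨-, hQ⟩ := hint _ (liftT cov A) b (liftT cov C) d hU'
    (smooth fun q hq ↦ genSmoothAt_liftT hcov (hA' _ hq)) (smooth hb)
    (smooth fun q hq ↦ genSmoothAt_liftT hcov (hC' _ hq)) (smooth hd) (eigen hAb) (eigen hCd) p hpU
  rw [h, h0, sub_zero, courant_swap (liftT cov C) b] at hQ
  have hQ' := congrArg (splitF cov p) hQ
  rw [splitF_splitFInv, splitF_add, splitF_neg, hw, hw', ← sub_eq_add_neg, ← map_sub, hJ.J_inclV,
    splitF_courant_liftT hcov hp (Filter.mem_of_superset (hU.mem_nhds hpU) hA')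
      (Filter.mem_of_superset (hU.mem_nhds hpU) hC')] at hQ'
  rw [← projT_inclT (V := V) p.proj (courant 𝓘(ℝ, E) A C p.proj), ← hQ', projT_inclT]

theorem IsLiftOf.isDirac_diracV [T2Space M] (hcov : cov.ContMDiffCovariantDerivative ∞)
    (h : IsLiftOf cov 𝒥 J) (hJ : IsAdapted J) (hint : 𝒥.IsIntegrable) :
    IsDirac 𝓘(ℝ, E) (diracV J) := by
  refine ⟨⟨hJ.isSubbundle_diracV, hJ.maximal_isotropic_diracV⟩, fun U A C hU hA hC x hx ↦ ?_⟩
  have hs {A} (hA : IsSectionOn 𝓘(ℝ, E) (diracV J) U A) (x) (hx : x ∈ U) :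
      SmoothAt 𝓘(ℝ, E) F (fun x ↦ (baseInv J x (A x)).1) x :=
    (smoothOn_iff hU).1 (genSmoothOn_baseInv J hU hA.1).1 x hx
  have hl {A} (hA : IsSectionOn 𝓘(ℝ, E) (diracV J) U A) (q : TotalSpace F V) (hq : q.proj ∈ U) :
      liftV (fun x ↦ (baseInv J x (A x)).1) q =
        splitFInv cov q (inclV q.proj (baseInv J q.proj (A q.proj))) := by
    rw [← splitFInv_inclV_left (cov := cov)]
    exact congrArg _ (congrArg _ (Prod.ext rfl (hJ.mem_diracV.1 (hA.2 _ hq)).symm))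
  have hg {A} (hA : IsSectionOn 𝓘(ℝ, E) (diracV J) U A) : GenSmoothAt A x :=
    ⟨(smoothOn_iff hU).1 hA.1.1 x hx, (dualSmoothOn_iff hU).1 hA.1.2 x hx⟩
  have key {A C} (hA : IsSectionOn 𝓘(ℝ, E) (diracV J) U A)
      (hC : IsSectionOn 𝓘(ℝ, E) (diracV J) U C) :=
    splitF_courant_liftT_liftV hcov (p := TotalSpace.mk' F x (0 : V x)) (hg hA) (hs hC x hx)
  obtain ⟨u, hu⟩ := key hA hC
  obtain ⟨u', hu'⟩ := key hC hA
  refine ⟨u - u', Eq.trans ?_ (courant_eq_baseMap hcov h hJ hint hU hA.1 hC.1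
    (fun q hq ↦ genSmoothAt_liftV (hs hA _ hq)) (fun q hq ↦ genSmoothAt_liftV (hs hC _ hq))
    (hl hA) (hl hC) (p := TotalSpace.mk' F x (0 : V x)) rfl hx
    (courant_liftV_liftV hcov (hs hA x hx) (hs hC x hx)) hu hu').symm⟩
  exact congrArg (baseMap J x) (Prod.ext rfl (sub_zero 0).symm)

theorem IsLiftOf.isDirac_diracVDual [T2Space M] (hcov : cov.ContMDiffCovariantDerivative ∞)
    (h : IsLiftOf cov 𝒥 J) (hJ : IsAdapted J) (hint : 𝒥.IsIntegrable) :
    IsDirac 𝓘(ℝ, E) (diracVDual J) := by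
  refine ⟨⟨hJ.isSubbundle_diracVDual, hJ.maximal_isotropic_diracVDual⟩,
    fun U A C hU hA hC x hx ↦ ?_⟩
  have hs {A} (hA : IsSectionOn 𝓘(ℝ, E) (diracVDual J) U A) (x) (hx : x ∈ U) :
      DualSmoothAt 𝓘(ℝ, E) F (fun x ↦ (baseInv J x (A x)).2) x :=
    (dualSmoothOn_iff hU).1 (genSmoothOn_baseInv J hU hA.1).2 x hx
  have hl {A} (hA : IsSectionOn 𝓘(ℝ, E) (diracVDual J) U A) (q : TotalSpace F V)
      (hq : q.proj ∈ U) : liftVd cov (fun x ↦ (baseInv J x (A x)).2) q =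
        splitFInv cov q (inclV q.proj (baseInv J q.proj (A q.proj))) := by
    rw [← splitFInv_inclV_right]
    exact congrArg _ (congrArg _ (Prod.ext (hJ.mem_diracVDual.1 (hA.2 _ hq)).symm rfl))
  have hg {A} (hA : IsSectionOn 𝓘(ℝ, E) (diracVDual J) U A) : ∀ᶠ y in 𝓝 x, GenSmoothAt A y :=
    Filter.mem_of_superset (hU.mem_nhds hx) fun y hy ↦
      ⟨(smoothOn_iff hU).1 hA.1.1 y hy, (dualSmoothOn_iff hU).1 hA.1.2 y hy⟩
  have key {A C} (hA : IsSectionOn 𝓘(ℝ, E) (diracVDual J) U A)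
      (hC : IsSectionOn 𝓘(ℝ, E) (diracVDual J) U C) :=
    splitF_courant_liftT_liftVd hcov (p := TotalSpace.mk' F x (0 : V x)) rfl (hg hA) (hs hC x hx)
  obtain ⟨u, hu⟩ := key hA hC
  obtain ⟨u', hu'⟩ := key hC hA
  refine ⟨u - u', Eq.trans ?_ (courant_eq_baseMap hcov h hJ hint hU hA.1 hC.1
    (fun q hq ↦ genSmoothAt_liftVd hcov (hs hA _ hq))
    (fun q hq ↦ genSmoothAt_liftVd hcov (hs hC _ hq))
    (hl hA) (hl hC) (p := TotalSpace.mk' F x (0 : V x)) rfl hx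
    (courant_liftVd_liftVd hcov (hs hA x hx) (hs hC x hx)) hu hu').symm⟩
  exact congrArg (baseMap J x) (Prod.ext (sub_zero 0).symm rfl)

end Dirac

section Transport

variable {E : Type*} [NormedAddCommGroup E] [NormedSpace ℝ E] [FiniteDimensional ℝ E]
  {H : Type*} [TopologicalSpace H] {I : ModelWithCorners ℝ E H}
  {B : Type*} [TopologicalSpace B] [ChartedSpace H B] [IsManifold I 2 B]
  {W : B → Type*} [∀ x, AddCommGroup (W x)] [∀ x, Module ℝ (W x)]

/-- Transport of a flat connection along an isomorphism onto a subbundle of `T ⊕ T^∨`. Here `S U`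
is the set of smooth sections over `U` of the bundle `W`. -/
theorem exists_flat_subbundleConnection
    {Δ : Π x : B, Submodule ℝ (Gen (TangentSpace I : B → Type _) x)}
    (S : Set B → (Π x, W x) → Prop) (C : (Π x, W x) → Π x : B, TangentSpace I x →ₗ[ℝ] W x)
    (L : Π x : B, W x →ₗ[ℝ] Gen (TangentSpace I : B → Type _) x)
    (R : Π x : B, Gen (TangentSpace I : B → Type _) x →ₗ[ℝ] W x)
    (hRL : ∀ x w, R x (L x w) = w) (hLR : ∀ x, ∀ c ∈ Δ x, L x (R x c) = c)
    (hL : ∀ x w, L x w ∈ Δ x)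
    (hLS : ∀ U s, IsOpen U → S U s → GenSmoothOn I E U fun x ↦ L x (s x))
    (hRS : ∀ (U : Set B) (a : Π x : B, Gen (TangentSpace I : B → Type _) x), IsOpen U →
      GenSmoothOn I E U a → S U fun x ↦ R x (a x))
    (congr : ∀ U s t, IsOpen U → S U s → S U t → (∀ x ∈ U, s x = t x) → ∀ x ∈ U, C s x = C t x)
    (smooth : ∀ (U : Set B) (s) (X : Π x : B, TangentSpace I x), IsOpen U → S U s →
      SmoothOn I E U X → S U fun x ↦ C s x (X x))
    (add : ∀ U s t, IsOpen U → S U s → S U t → ∀ x ∈ U, ∀ v,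
      C (fun y ↦ s y + t y) x v = C s x v + C t x v)
    (leibniz : ∀ (U : Set B) (f : B → ℝ) (s), IsOpen U → ContMDiffOn I 𝓘(ℝ, ℝ) ∞ f U → S U s →
      ∀ x ∈ U, ∀ v, C (fun y ↦ f y • s y) x v = f x • C s x v + mvfderiv I f x v • s x)
    (flat : ∀ (U : Set B) (X Y : Π x : B, TangentSpace I x) (s), IsOpen U → SmoothOn I E U X →
      SmoothOn I E U Y → S U s → ∀ x ∈ U,
      C (fun y ↦ C s y (Y y)) x (X x) - C (fun y ↦ C s y (X y)) x (Y x)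
        - C s x (VectorField.mlieBracket I X Y x) = 0) :
    ∃ D : SubbundleConnection I Δ, D.IsFlat ∧ ∀ (U : Set B) (s : Π x, W x), IsOpen U → S U s →
      ∀ x ∈ U, ∀ v : TangentSpace I x, D.toFun (fun y ↦ L y (s y)) x v = L x (C s x v) := by
  have (x : B) : FiniteDimensional ℝ (TangentSpace I x) := inferInstanceAs (FiniteDimensional ℝ E)
  have (x : B) : T2Space (TangentSpace I x) := inferInstanceAs (T2Space E)
  let T (a : Π x : B, Gen (TangentSpace I : B → Type _) x) (x : B) :
      TangentSpace I x →L[ℝ] Gen (TangentSpace I : B → Type _) x :=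
    LinearMap.toContinuousLinearMap ((L x).comp (C (fun y ↦ R y (a y)) x))
  have hT (a) (x) (v) : T a x v = L x (C (fun y ↦ R y (a y)) x v) := rfl
  refine ⟨{
    toFun := T
    congr := fun U a a' hU ha ha' h x hx ↦ ?_
    isSectionOn := fun U a X hU ha hX ↦
      ⟨hLS U _ hU (smooth U _ X hU (hRS U a hU ha.1) hX), fun x _ ↦ hL _ _⟩
    add := fun U a a' hU ha ha' x hx ↦ ?_
    leibniz := fun U f a hU hf ha x hx v ↦ ?_ }, fun U X Y a hU hX hY ha x hx ↦ ?_,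
    fun U s hU hs x hx v ↦ ?_⟩
  · ext1 v
    rw [hT, hT, congr U _ _ hU (hRS U a hU ha.1) (hRS U a' hU ha'.1)
      (fun y hy ↦ by rw [h y hy]) x hx]
  · ext1 v
    rw [add_apply, hT, hT, hT, ← map_add,
      ← add U _ _ hU (hRS U a hU ha.1) (hRS U a' hU ha'.1) x hx]
    simp only [map_add]
  · rw [hT, hT]
    simp only [map_smul]
    rw [leibniz U f _ hU hf (hRS U a hU ha.1) x hx, map_add, map_smul, map_smul,
      hLR x _ (ha.2 x hx)]
  · change T (fun y ↦ T a y (Y y)) x (X x) - T (fun y ↦ T a y (X y)) x (Y x) - T a x _ = 0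
    simp only [hT, hRL]
    rw [← map_sub, ← map_sub, flat U X Y _ hU hX hY (hRS U a hU ha.1) x hx, map_zero]
  · change T _ x v = _
    simp only [hT, hRL]

end Transport

section Connections

variable {E : Type*} [NormedAddCommGroup E] [NormedSpace ℝ E] [FiniteDimensional ℝ E]
  {M : Type*} [TopologicalSpace M] [ChartedSpace E M] [IsManifold 𝓘(ℝ, E) ∞ M]
  {F : Type*} [NormedAddCommGroup F] [NormedSpace ℝ F] [FiniteDimensional ℝ F]
  {V : M → Type*} [TopologicalSpace (TotalSpace F V)]
  [∀ x, AddCommGroup (V x)] [∀ x, Module ℝ (V x)] [∀ x, TopologicalSpace (V x)]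
  [∀ x, IsTopologicalAddGroup (V x)] [∀ x, ContinuousSMul ℝ (V x)]
  [FiberBundle F V] [VectorBundle ℝ F V] [ContMDiffVectorBundle ∞ F V 𝓘(ℝ, E)]
  {cov : CovariantDerivative 𝓘(ℝ, E) F V} {J : GACS 𝓘(ℝ, E) (F × E) (VT E V)}

theorem dualCov_apply_eq {ξ : Π x, V x →L[ℝ] ℝ} {x : M} (hξ : DualSmoothAt 𝓘(ℝ, E) F ξ x)
    (v : TangentSpace 𝓘(ℝ, E) x) {s : Π x, V x} (hs : SmoothNear 𝓘(ℝ, E) F s x) :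
    dualCov cov ξ x v (s x) = mvfderiv 𝓘(ℝ, E) (fun y ↦ ξ y (s y)) x v - ξ x (cov s x v) :=
  dualCov_apply cov hξ.dualMDiffAt hs.smoothAt.mdifferentiableAt v

theorem ext_smoothNear {x : M} {φ ψ : V x →L[ℝ] ℝ}
    (h : ∀ s : Π x, V x, SmoothNear 𝓘(ℝ, E) F s x → φ (s x) = ψ (s x)) : φ = ψ := by
  ext u
  obtain ⟨s, hs, rfl⟩ := exists_smoothNear_eq (E := E) (F := F) u
  exact h s hs

theorem dualCov_congr {ξ ζ : Π x, V x →L[ℝ] ℝ} {x : M} (hξ : DualSmoothAt 𝓘(ℝ, E) F ξ x)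
    (hζ : DualSmoothAt 𝓘(ℝ, E) F ζ x) (h : ∀ᶠ y in 𝓝 x, ξ y = ζ y) :
    dualCov cov ξ x = dualCov cov ζ x := by
  ext1 v
  refine ext_smoothNear (E := E) (F := F) fun s hs ↦ ?_
  rw [dualCov_apply_eq hξ v hs, dualCov_apply_eq hζ v hs, h.self_of_nhds,
    mvfderiv_congr (g := fun y ↦ ζ y (s y)) (h.mono fun y hy ↦ by simp only [hy])]

theorem DualSmoothAt.add {ξ ζ : Π x, V x →L[ℝ] ℝ} {x : M} (hξ : DualSmoothAt 𝓘(ℝ, E) F ξ x)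
    (hζ : DualSmoothAt 𝓘(ℝ, E) F ζ x) : DualSmoothAt 𝓘(ℝ, E) F (fun y ↦ ξ y + ζ y) x :=
  dualSmoothAt_of_forall fun _ hs ↦ (hξ.apply hs.smoothAt).add (hζ.apply hs.smoothAt)

theorem DualSmoothAt.smul {ξ : Π x, V x →L[ℝ] ℝ} {f : M → ℝ} {x : M}
    (hf : ContMDiffAt 𝓘(ℝ, E) 𝓘(ℝ, ℝ) ∞ f x) (hξ : DualSmoothAt 𝓘(ℝ, E) F ξ x) :
    DualSmoothAt 𝓘(ℝ, E) F (fun y ↦ f y • ξ y) x :=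
  dualSmoothAt_of_forall fun _ hs ↦ hf.smul (hξ.apply hs.smoothAt)

theorem dualCov_add {ξ ζ : Π x, V x →L[ℝ] ℝ} {x : M} (hξ : DualSmoothAt 𝓘(ℝ, E) F ξ x)
    (hζ : DualSmoothAt 𝓘(ℝ, E) F ζ x) (v : TangentSpace 𝓘(ℝ, E) x) :
    dualCov cov (fun y ↦ ξ y + ζ y) x v = dualCov cov ξ x v + dualCov cov ζ x v := by
  refine ext_smoothNear (E := E) (F := F) fun s hs ↦ ?_
  have h : (fun y ↦ (ξ y + ζ y) (s y)) = (fun y ↦ ξ y (s y)) + fun y ↦ ζ y (s y) := rfl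
  rw [add_apply, dualCov_apply_eq hξ v hs, dualCov_apply_eq hζ v hs,
    dualCov_apply_eq (hξ.add hζ) v hs, h,
    mvfderiv_add ((hξ.apply hs.smoothAt).mdifferentiableAt (by simp))
      ((hζ.apply hs.smoothAt).mdifferentiableAt (by simp))]
  simp only [add_apply]
  ring

theorem dualCov_smul {ξ : Π x, V x →L[ℝ] ℝ} {f : M → ℝ} {x : M}
    (hf : ContMDiffAt 𝓘(ℝ, E) 𝓘(ℝ, ℝ) ∞ f x) (hξ : DualSmoothAt 𝓘(ℝ, E) F ξ x)
    (v : TangentSpace 𝓘(ℝ, E) x) :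
    dualCov cov (fun y ↦ f y • ξ y) x v =
      f x • dualCov cov ξ x v + mvfderiv 𝓘(ℝ, E) f x v • ξ x := by
  refine ext_smoothNear (E := E) (F := F) fun s hs ↦ ?_
  have h : (fun y ↦ (f y • ξ y) (s y)) = f • fun y ↦ ξ y (s y) := rfl
  rw [dualCov_apply_eq (DualSmoothAt.smul hf hξ) v hs, h,
    mvfderiv_smul (hf.mdifferentiableAt (by simp))
      ((hξ.apply hs.smoothAt).mdifferentiableAt (by simp))]
  simp only [add_apply, smul_apply, dualCov_apply_eq hξ v hs]
  simp
  ring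

theorem IsAdapted.exists_flat_connection_diracV [T2Space M] (hJ : IsAdapted J)
    (hcov : cov.ContMDiffCovariantDerivative ∞) (hflat : IsFlat cov) :
    ∃ D : SubbundleConnection 𝓘(ℝ, E) (diracV J), D.IsFlat ∧
      ∀ (U : Set M) (s : Π x, V x), IsOpen U → SmoothOn 𝓘(ℝ, E) F U s →
        ∀ x ∈ U, ∀ v : TangentSpace 𝓘(ℝ, E) x,
          D.toFun (fun y ↦ baseMap J y (s y, 0)) x v = baseMap J x (cov s x v, 0) := by
  refine exists_flat_subbundleConnection (fun U s ↦ SmoothOn 𝓘(ℝ, E) F U s)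
    (fun s x ↦ (cov s x : TangentSpace 𝓘(ℝ, E) x →ₗ[ℝ] V x))
    (fun x ↦ (baseMap J x).comp (LinearMap.inl ℝ (V x) (V x →L[ℝ] ℝ)))
    (fun x ↦ (LinearMap.fst ℝ (V x) (V x →L[ℝ] ℝ)).comp (baseInv J x))
    (fun x u ↦ congrArg Prod.fst (hJ.baseInv_baseMap x (u, 0))) (fun x c hc ↦ ?_)
    (fun x u ↦ ⟨u, rfl⟩) (fun U s hU hs ↦ genSmoothOn_baseMap J hU (genSmoothOn_left hU hs))
    (fun U a hU ha ↦ (genSmoothOn_baseInv J hU ha).1) (fun U s t hU hs ht h x hx ↦ ?_)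
    (fun U s X hU hs hX ↦ (smoothOn_iff hU).2 fun x hx ↦
      cov_smoothAt hcov (hs.near hU hx) ((smoothOn_iff hU).1 hX x hx))
    (fun U s t hU hs ht x hx v ↦ ?_) (fun U f s hU hf hs x hx v ↦ ?_) hflat
  · rw [← hJ.baseMap_baseInv x c]
    exact congrArg (baseMap J x) (Prod.ext (by simp [hJ.baseInv_baseMap])
      (hJ.mem_diracV.1 hc).symm)
  · have := cov_congr (cov := cov) ((smoothOn_iff hU).1 hs x hx) ((smoothOn_iff hU).1 ht x hx)
      (Filter.mem_of_superset (hU.mem_nhds hx) h)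
    rw [this]
  · exact congrArg (fun l : TangentSpace 𝓘(ℝ, E) x →L[ℝ] V x ↦ l v)
      (cov.isCovariantDerivativeOnUniv.add ((smoothOn_iff hU).1 hs x hx).mdifferentiableAt
        ((smoothOn_iff hU).1 ht x hx).mdifferentiableAt)
  · have := congrArg (fun l : TangentSpace 𝓘(ℝ, E) x →L[ℝ] V x ↦ l v)
      (cov.isCovariantDerivativeOnUniv.leibniz ((smoothOn_iff hU).1 hs x hx).mdifferentiableAt
        ((hf.contMDiffAt (hU.mem_nhds hx)).mdifferentiableAt (by simp)))
    refine Eq.trans (b := cov (f • s) x v) rfl ?_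
    simpa using this

theorem IsAdapted.exists_flat_connection_diracVDual [T2Space M] (hJ : IsAdapted J)
    (hcov : cov.ContMDiffCovariantDerivative ∞) (hflat : IsFlat cov) :
    ∃ D : SubbundleConnection 𝓘(ℝ, E) (diracVDual J), D.IsFlat ∧
      ∀ (U : Set M) (ξ : Π x, V x →L[ℝ] ℝ), IsOpen U → DualSmoothOn 𝓘(ℝ, E) F U ξ →
        ∀ x ∈ U, ∀ v : TangentSpace 𝓘(ℝ, E) x,
          D.toFun (fun y ↦ baseMap J y (0, ξ y)) x v = baseMap J x (0, dualCov cov ξ x v) := by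
  refine exists_flat_subbundleConnection (fun U ξ ↦ DualSmoothOn 𝓘(ℝ, E) F U ξ)
    (fun ξ x ↦ (dualCov cov ξ x : TangentSpace 𝓘(ℝ, E) x →ₗ[ℝ] V x →L[ℝ] ℝ))
    (fun x ↦ (baseMap J x).comp (LinearMap.inr ℝ (V x) (V x →L[ℝ] ℝ)))
    (fun x ↦ (LinearMap.snd ℝ (V x) (V x →L[ℝ] ℝ)).comp (baseInv J x))
    (fun x u ↦ congrArg Prod.snd (hJ.baseInv_baseMap x (0, u))) (fun x c hc ↦ ?_)
    (fun x u ↦ ⟨u, rfl⟩) (fun U s hU hs ↦ genSmoothOn_baseMap J hU (genSmoothOn_right hs))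
    (fun U a hU ha ↦ (genSmoothOn_baseInv J hU ha).2) (fun U s t hU hs ht h x hx ↦ ?_)
    (fun U s X hU hs hX ↦ (dualSmoothOn_iff hU).2 fun x hx ↦
      dualCov_smoothAt hcov (hs.near hU hx) ((smoothOn_iff hU).1 hX x hx))
    (fun U s t hU hs ht x hx v ↦ dualCov_add ((dualSmoothOn_iff hU).1 hs x hx)
      ((dualSmoothOn_iff hU).1 ht x hx) v)
    (fun U f s hU hf hs x hx v ↦ dualCov_smul (hf.contMDiffAt (hU.mem_nhds hx))
      ((dualSmoothOn_iff hU).1 hs x hx) v)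
    (fun U X Y s hU hX hY hs x hx ↦ dualCov_flat hcov hflat (hs.near hU hx) (hX.near hU hx)
      (hY.near hU hx))
  · rw [← hJ.baseMap_baseInv x c]
    exact congrArg (baseMap J x) (Prod.ext (hJ.mem_diracVDual.1 hc).symm
      (by simp [hJ.baseInv_baseMap]))
  · have := dualCov_congr (cov := cov) ((dualSmoothOn_iff hU).1 hs x hx)
      ((dualSmoothOn_iff hU).1 ht x hx) (Filter.mem_of_superset (hU.mem_nhds hx) h)
    rw [this]

end Connections

end GenGeom

end

theorem mainTheorem6
    {E : Type*} [NormedAddCommGroup E] [NormedSpace ℝ E] [FiniteDimensional ℝ E]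
    {M : Type*} [TopologicalSpace M] [T2Space M] [SecondCountableTopology M] [ChartedSpace E M]
    [IsManifold 𝓘(ℝ, E) ∞ M]
    {F : Type*} [NormedAddCommGroup F] [NormedSpace ℝ F] [FiniteDimensional ℝ F]
    {V : M → Type*} [TopologicalSpace (TotalSpace F V)]
    [∀ x, AddCommGroup (V x)] [∀ x, Module ℝ (V x)] [∀ x, TopologicalSpace (V x)]
    [∀ x, IsTopologicalAddGroup (V x)] [∀ x, ContinuousSMul ℝ (V x)]
    [FiberBundle F V] [VectorBundle ℝ F V] [ContMDiffVectorBundle ∞ F V 𝓘(ℝ, E)]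
    (cov : CovariantDerivative 𝓘(ℝ, E) F V) (hcov : cov.ContMDiffCovariantDerivative ∞)
    (𝒥 : GenGeom.GACS (𝓘(ℝ, E).prod 𝓘(ℝ, F)) (E × F)
      (TangentSpace (𝓘(ℝ, E).prod 𝓘(ℝ, F)) : TotalSpace F V → Type _))
    (hsf : GenGeom.IsSemiFlat cov 𝒥) (hint : 𝒥.IsIntegrable) :
    ∃ J : GenGeom.GACS 𝓘(ℝ, E) (F × E) (GenGeom.VT E V),
      (GenGeom.IsLiftOf cov 𝒥 J ∧ ∀ J', GenGeom.IsLiftOf cov 𝒥 J' → J' = J) ∧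
      GenGeom.IsAdapted J ∧
      GenGeom.IsDirac 𝓘(ℝ, E) (GenGeom.diracV J) ∧
      GenGeom.IsDirac 𝓘(ℝ, E) (GenGeom.diracVDual J) ∧
      (∀ x, IsCompl (GenGeom.diracV J x) (GenGeom.diracVDual J x)) ∧
      (∃ D : GenGeom.SubbundleConnection 𝓘(ℝ, E) (GenGeom.diracV J),
        D.IsFlat ∧
        ∀ (U : Set M) (s : Π x, V x), IsOpen U → GenGeom.SmoothOn 𝓘(ℝ, E) F U s →
          ∀ x ∈ U, ∀ v : TangentSpace 𝓘(ℝ, E) x,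
            D.toFun (fun y ↦ GenGeom.baseMap J y (s y, 0)) x v =
              GenGeom.baseMap J x (cov s x v, 0)) ∧
      (∃ D : GenGeom.SubbundleConnection 𝓘(ℝ, E) (GenGeom.diracVDual J),
        D.IsFlat ∧
        ∀ (U : Set M) (ξ : Π x, V x →L[ℝ] ℝ), IsOpen U → GenGeom.DualSmoothOn 𝓘(ℝ, E) F U ξ →
          ∀ x ∈ U, ∀ v : TangentSpace 𝓘(ℝ, E) x,
            D.toFun (fun y ↦ GenGeom.baseMap J y (0, ξ y)) x v =
              GenGeom.baseMap J x (0, GenGeom.dualCov cov ξ x v)) := by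
  obtain ⟨hflat, J, hlift, hJ⟩ := hsf
  exact ⟨J, ⟨hlift, fun _ h ↦ hlift.unique h⟩, hJ, hlift.isDirac_diracV hcov hJ hint,
    hlift.isDirac_diracVDual hcov hJ hint, hJ.isCompl,
    hJ.exists_flat_connection_diracV hcov hflat, hJ.exists_flat_connection_diracVDual hcov hflat⟩
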